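/- Let $\mathrm{Nil}_3$ be the Heisenberg group, i.e. $\mathbb{R}^3$ with the left-invariant metric $\hat g = dx^2+dy^2+\big(dz+\tfrac12(y\,dx-x\,dy)\big)^2$. For each $a>0$ there is a unique positive $C^2$ function $f(a,\cdot):\mathbb{R}\to\mathbb{R}$ with $$f(f^2+4)f_{tt}=4(1+f_t^2),\qquad f(a,0)=a,\qquad f_t(a,0)=0 .$$ The catenoid $\mathcal{C}_a$ is the minimal surface of revolution parametrized by $F(a,t,\theta)=(f(a,t)\cos\theta,\,f(a,t)\sin\theta,\,t)$. Let $N$ be its unit normal field which at $F(a,0,\theta)$ equals $-(\cos\theta\,\partial_x+\sin\theta\,\partial_y)$, let $A$ be its second fundamental form, and let $J=-\Delta-(|A|^2+\widehat{\mathrm{Ric}}(N,N))$ be its Jacobi operator, where $\Delta$ is the non-positive Laplacian of the induced metric. For $\Omega\subset\mathcal{C}_a$ let $\lambda_1(\Omega)$ be the least eigenvalue of $J$ with Dirichlet boundary conditions on $\Omega$, i.e. the infimum of $\int uJu\,/\int u^2$ over the non-zero smooth functions $u$ with compact support in the interior of $\Omega$ relative to $\mathcal{C}_a$. A relatively compact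 domain $\Omega$ is stable if $\lambda_1(\Omega)>0$ and stable-unstable if $\lambda_1(\Omega)=0$; a (not necessarily relatively compact) domain is r-stable if each of its relatively compact subdomains is stable. (Subdomains are non-empty, connected and relatively open; relative compactness is meant in $\mathcal{C}_a$.) Then, for every $a>0$: (i) The half-catenoids $\mathcal{C}_a\cap\{z>0\}$ and $\mathcal{C}_a\cap\{z<0\}$ are r-stable. (ii) The function $e=-\hat g(\partial F/\partial a,N)$ satisfies $Je=0$ on $\mathcal{C}_a$ and does not depend on $\theta$; $e(a,\cdot)$ is an even function of $t$ with exactly one zero $z(a)$ in $(0,\infty)$; and the domain $F(a,[-z(a),z(a)],[0,2\pi])$ is stable-unstable. (iii) For every $t_1>0$ there is $t_2>0$ such that the domain $F(a,[-t_1,t_2],[0,2\pi])$ is stable-unstable. Moreover each of the two half-catenoids $\mathcal{C}_a\cap\{z>0\}$ and $\mathcal{C}_a\cap\{z<0\}$ is maximal, with respect to inclusion, among the rotationally invariant r-stable domains (non-empty, connected, relatively open subsets) of $\mathcal{C}_a$. -/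

import Mathlib

noncomputable section

namespace NilCatenoid

open scoped ContDiff Topology Matrix

/-! ### Riemannian geometry in coordinates -/

/-- Partial derivative in the `i`-th coordinate direction. -/
def pd {n : ℕ} {E : Type*} [NormedAddCommGroup E] [NormedSpace ℝ E]
    (i : Fin n) (u : (Fin n → ℝ) → E) (q : Fin n → ℝ) : E :=
  fderiv ℝ u q (Pi.single i 1)

/-- Christoffel symbols `Γ^k_{ij}` of the Levi-Civita connection of a metric `G` given by its
coefficients in coordinates. -/
def christoffel {n : ℕ} (G : (Fin n → ℝ) → Matrix (Fin n) (Fin n) ℝ)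
    (k i j : Fin n) (p : Fin n → ℝ) : ℝ :=
  (1 / 2) * ∑ l, (G p)⁻¹ k l *
    (pd i (fun x => G x j l) p + pd j (fun x => G x i l) p - pd l (fun x => G x i j) p)

/-- Coefficients `R_{ij}` of the Ricci tensor of `G` (positive on round spheres). -/
def ricci {n : ℕ} (G : (Fin n → ℝ) → Matrix (Fin n) (Fin n) ℝ)
    (i j : Fin n) (p : Fin n → ℝ) : ℝ :=
  ∑ k, (pd k (christoffel G k i j) p - pd j (christoffel G k i k) p
    + ∑ l, (christoffel G k k l p * christoffel G l i j p
      - christoffel G k j l p * christoffel G l i k p))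

/-! ### The Heisenberg group with its left-invariant metric -/

/-- `Nil₃` in exponential coordinates `(x, y, z)`. -/
abbrev Nil : Type := Fin 3 → ℝ

/-- The left-invariant frame `X = ∂x - (y/2) ∂z`. -/
def frameX (p : Nil) : Nil := ![1, 0, -(p 1 / 2)]

/-- The left-invariant frame `Y = ∂y + (x/2) ∂z`. -/
def frameY (p : Nil) : Nil := ![0, 1, p 0 / 2]

/-- The left-invariant frame `Z = ∂z`. -/
def frameZ (_p : Nil) : Nil := ![0, 0, 1]

/-- The metric `dx² + dy² + (dz + (y dx - x dy)/2)²`, as a bilinear form at `p`. -/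
def nilInner (p v w : Nil) : ℝ :=
  v 0 * w 0 + v 1 * w 1
    + (v 2 + (p 1 * v 0 - p 0 * v 1) / 2) * (w 2 + (p 1 * w 0 - p 0 * w 1) / 2)

/-- The coefficients of the metric in the coordinates `(x, y, z)`. -/
def nilMetric (p : Nil) : Matrix (Fin 3) (Fin 3) ℝ :=
  Matrix.of fun i j => nilInner p (Pi.single i 1) (Pi.single j 1)

/-- The Ricci quadratic form of `Nil₃` at `p`. -/
def nilRic (p v : Nil) : ℝ := ∑ i, ∑ j, ricci nilMetric i j p * v i * v j

/-- Rotation of angle `θ` around the `z`-axis. -/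
def rot (θ : ℝ) (p : Nil) : Nil :=
  ![p 0 * Real.cos θ - p 1 * Real.sin θ, p 0 * Real.sin θ + p 1 * Real.cos θ, p 2]

/-! ### Immersed surfaces `Φ` in `Nil₃`, with parameters `q = (q 0, q 1)` -/

/-- First fundamental form. -/
def firstFF (Φ : (Fin 2 → ℝ) → Nil) (q : Fin 2 → ℝ) : Matrix (Fin 2) (Fin 2) ℝ :=
  Matrix.of fun i j => nilInner (Φ q) (pd i Φ q) (pd j Φ q)

/-- Density of the Riemannian area with respect to `dq₀ dq₁`. -/
def areaDensity (Φ : (Fin 2 → ℝ) → Nil) (q : Fin 2 → ℝ) : ℝ :=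
  Real.sqrt (firstFF Φ q).det

/-- Second fundamental form with respect to the normal field `N`:
`h_{ij} = ⟨∇_{∂ᵢΦ} ∂ⱼΦ, N⟩`. -/
def secondFF (Φ N : (Fin 2 → ℝ) → Nil) (i j : Fin 2) (q : Fin 2 → ℝ) : ℝ :=
  nilInner (Φ q)
    (fun k => pd i (pd j Φ) q k
      + ∑ l, ∑ m, christoffel nilMetric k l m (Φ q) * pd i Φ q l * pd j Φ q m)
    (N q)

/-- Squared norm `|A|²` of the second fundamental form. -/
def normSqA (Φ N : (Fin 2 → ℝ) → Nil) (q : Fin 2 → ℝ) : ℝ :=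
  ∑ i, ∑ j, ∑ k, ∑ l, (firstFF Φ q)⁻¹ i k * (firstFF Φ q)⁻¹ j l
    * secondFF Φ N i j q * secondFF Φ N k l q

/-- Laplace-Beltrami operator (non-positive) of the induced metric. -/
def laplacian (Φ : (Fin 2 → ℝ) → Nil) (u : (Fin 2 → ℝ) → ℝ) (q : Fin 2 → ℝ) : ℝ :=
  (areaDensity Φ q)⁻¹ *
    ∑ i, pd i (fun x => areaDensity Φ x * ∑ j, (firstFF Φ x)⁻¹ i j * pd j u x) q

/-- The Jacobi operator `J u = -Δ u - (|A|² + Ric(N, N)) u`. -/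
def jacobiOp (Φ N : (Fin 2 → ℝ) → Nil) (u : (Fin 2 → ℝ) → ℝ) (q : Fin 2 → ℝ) : ℝ :=
  -laplacian Φ u q - (normSqA Φ N q + nilRic (Φ q) (N q)) * u q

/-! ### Surfaces of revolution and catenoids -/

/-- The surface of revolution `(t, θ) ↦ (g(t) cos θ, g(t) sin θ, t)`. -/
def revMap (g : ℝ → ℝ) (q : Fin 2 → ℝ) : Nil :=
  ![g (q 0) * Real.cos (q 1), g (q 0) * Real.sin (q 1), q 0]

/-- The surface of revolution as a subset of `Nil₃`. -/
def revSurface (g : ℝ → ℝ) : Set Nil := Set.range (revMap g)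

/-- The unit normal `N = W ((-cos θ - g g' sin θ / 2) X + (-sin θ + g g' cos θ / 2) Y + g' Z)`
with `W = (1 + g'² + g² g'² / 4)^(-1/2)`. -/
def revNormal (g : ℝ → ℝ) (q : Fin 2 → ℝ) : Nil :=
  (Real.sqrt (1 + deriv g (q 0) ^ 2 + g (q 0) ^ 2 * deriv g (q 0) ^ 2 / 4))⁻¹ •
    ((-Real.cos (q 1) - g (q 0) * deriv g (q 0) * Real.sin (q 1) / 2) • frameX (revMap g q)
      + (-Real.sin (q 1) + g (q 0) * deriv g (q 0) * Real.cos (q 1) / 2) • frameY (revMap g q)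
      + deriv g (q 0) • frameZ (revMap g q))

/-- `g` is a global positive solution of the Cauchy problem
`g (g² + 4) g'' = 4 (1 + g'²)`, `g(0) = a`, `g'(0) = 0`, so that `revSurface g` is the
catenoid `C_a`. -/
structure IsCatenoidProfile (a : ℝ) (g : ℝ → ℝ) : Prop where
  contDiff : ContDiff ℝ 2 g
  pos : ∀ t, 0 < g t
  ode : ∀ t, g t * (g t ^ 2 + 4) * deriv (deriv g) t = 4 * (1 + deriv g t ^ 2)
  init : g 0 = a
  init_deriv : deriv g 0 = 0

/-- For a family of profiles `f a`, the function `e(a, ·) = -⟨∂F/∂a, N⟩` on the surface of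
parameter `a`. -/
def variationJacobi (f : ℝ → ℝ → ℝ) (a : ℝ) (q : Fin 2 → ℝ) : ℝ :=
  -nilInner (revMap (f a) q) (deriv (fun b => revMap (f b) q) a) (revNormal (f a) q)

/-- The rotationally invariant (closed) annulus `D(s, t) = F([s, t] × [0, 2π])`. -/
def annulus (g : ℝ → ℝ) (s t : ℝ) : Set Nil :=
  revMap g '' {q | q 0 ∈ Set.Icc s t ∧ q 1 ∈ Set.Icc 0 (2 * Real.pi)}

/-! ### Stability of domains of the surface `M = revSurface g`

A function `u` on `M` is handled through its values `u ∘ revMap g` in the parameters. -/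

/-- Integral over `M` (with respect to the induced Riemannian measure) of a function given in
the parameters `(t, θ)`. -/
def surfaceIntegral (g : ℝ → ℝ) (h : (Fin 2 → ℝ) → ℝ) : ℝ :=
  ∫ t : ℝ, ∫ θ in (0 : ℝ)..(2 * Real.pi), h ![t, θ] * areaDensity (revMap g) ![t, θ]

/-- The interior of `Ω` relative to `M`. -/
def relInterior (M Ω : Set Nil) : Set Nil := {p | p ∈ M ∧ Ω ∈ 𝓝[M] p}

/-- `u` restricts to a smooth function on `M` with compact support in the interior of `Ω`. -/
def IsTestFunction (g : ℝ → ℝ) (Ω : Set Nil) (u : Nil → ℝ) : Prop :=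
  ContDiff ℝ ∞ (u ∘ revMap g) ∧
    ∃ K : Set Nil, IsCompact K ∧ K ⊆ relInterior (revSurface g) Ω ∧
      ∀ p ∈ revSurface g, p ∉ K → u p = 0

/-- The Rayleigh quotients `∫ u J u / ∫ u²` of the non-zero test functions on `Ω`. -/
def rayleighQuotients (g : ℝ → ℝ) (Ω : Set Nil) : Set ℝ :=
  {r | ∃ u : Nil → ℝ, IsTestFunction g Ω u ∧ (∃ p ∈ revSurface g, u p ≠ 0) ∧
    r = surfaceIntegral g (fun q => u (revMap g q) *
          jacobiOp (revMap g) (revNormal g) (u ∘ revMap g) q)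
        / surfaceIntegral g (fun q => u (revMap g q) ^ 2)}

/-- `lam` is the least eigenvalue `λ₁(Ω)` of the Jacobi operator with Dirichlet boundary
conditions on `Ω`. -/
def IsFirstEigenvalue (g : ℝ → ℝ) (Ω : Set Nil) (lam : ℝ) : Prop :=
  IsGLB (rayleighQuotients g Ω) lam

/-- `λ₁(Ω) > 0`. -/
def IsStable (g : ℝ → ℝ) (Ω : Set Nil) : Prop :=
  ∃ lam, IsFirstEigenvalue g Ω lam ∧ 0 < lam

/-- `λ₁(Ω) = 0`. -/
def IsStableUnstable (g : ℝ → ℝ) (Ω : Set Nil) : Prop :=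
  IsFirstEigenvalue g Ω 0

/-- A domain of `M`: a non-empty connected relatively open subset. -/
def IsDomainIn (M Ω : Set Nil) : Prop :=
  (∃ O : Set Nil, IsOpen O ∧ Ω = M ∩ O) ∧ IsConnected Ω

/-- Relatively compact subsets of `M`. -/
def IsRelCompactIn (M Ω : Set Nil) : Prop :=
  ∃ K : Set Nil, IsCompact K ∧ K ⊆ M ∧ Ω ⊆ K

/-- `Ω` is r-stable: every relatively compact subdomain of `Ω` is stable. -/
def IsRStable (g : ℝ → ℝ) (Ω : Set Nil) : Prop :=
  ∀ Ω' ⊆ Ω, IsDomainIn (revSurface g) Ω' → IsRelCompactIn (revSurface g) Ω' → IsStable g Ω'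

/-- Invariance under all rotations around the `z`-axis. -/
def IsRotInvariant (U : Set Nil) : Prop := ∀ θ : ℝ, rot θ '' U = U

/-- Rotationally invariant r-stable domains of `M`. -/
def IsRotRStableDomain (g : ℝ → ℝ) (U : Set Nil) : Prop :=
  IsDomainIn (revSurface g) U ∧ IsRotInvariant U ∧ IsRStable g U

/-- The upper half `M ∩ {z > 0}`. -/
def upperHalf (g : ℝ → ℝ) : Set Nil := revSurface g ∩ {p | 0 < p 2}

/-- The lower half `M ∩ {z < 0}`. -/
def lowerHalf (g : ℝ → ℝ) : Set Nil := revSurface g ∩ {p | p 2 < 0}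

end NilCatenoid

end

/-!
The proof reduces the stability of the catenoid `C_a` to one ordinary differential equation.

The profile equation has the first integral `(1 + g'²) (g² + 4) / g² = (a² + 4) / a²`. It turns the
equation into `g'' = K(g)` with `K` globally Lipschitz, which gives uniqueness, and makes all
geometric quantities rational in `g`: the area density is `D = g² / a`, and
`|A|² + Ric(N, N) = 2 (a² + 4) / (g² + 4)² + 2 a² / g⁴`. Hence
`D J u = -div (D ∇u) - κ u` has coefficients depending on `t` only, and on functions of `t` it is
the Sturm–Liouville operator `-(p w')' - κ w`. The profile itself is explicit in the
parameter `s` with `g = a cosh s`: the height is `∫₀ˢ (a / 2) √(a² cosh² σ + 4) dσ`, and the implicit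
function theorem gives its dependence on `a`.

Two rotationally invariant Jacobi fields are known: `φ = ⟨∂z, N⟩ = a g' / g`, which is odd and
positive for `t > 0`, and `e = -⟨∂F/∂a, N⟩`, which is even with `e(0) = 1`; moreover `e = 1 - φ τ` for
an explicit primitive `τ`. Their Wronskian is constant, so on `(0, ∞)` the ratio `e / φ` has
derivative `-1 / (p φ²) ≤ -1 / a` and decreases from `+∞` to `-∞`. Thus `e` has exactly one positive
zero, and every `t₁ > 0` has a unique conjugate `t₂ > 0`, with `(e / φ)(t₂) = -(e / φ)(t₁)`, such
that `e + (e / φ)(t₁) φ` vanishes at `-t₁` and `t₂` and is positive in between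
(`IsCatenoidProfile.exists_pair`).

A positive Jacobi field `w` gives the solution `r = p w' / w` of the Riccati equation
`r' + r² / p + κ = 0`, and completing the square shows that `∫ u J u ≥ 0`; perturbing `r` gives
`∫ u J u ≥ c ∫ u²` with `c > 0` when `w` is positive on a compact interval of heights
(`IsCatenoidProfile.mul_surfaceIntegral_le`, `IsJacobiPair.isStable`). When `w` vanishes at
both ends, the cutoffs `w χₙ` have energy `∫ p w² χₙ'² → 0`, so the least eigenvalue is exactly zero
(`IsJacobiPair.isStableUnstable`). Relatively compact domains in a half-catenoid lie in the interior
of a slab bounded by conjugate heights, hence are stable, whereas a rotationally invariant domain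
strictly larger than a half-catenoid contains a whole such slab, hence is not r-stable.
-/

noncomputable section

namespace NilCatenoid

open scoped ContDiff Topology Matrix

/-! ### Partial derivatives -/

lemma pd_eq_of_hasFDerivAt {n : ℕ} {E : Type*} [NormedAddCommGroup E] [NormedSpace ℝ E]
    {u : (Fin n → ℝ) → E} {u' : (Fin n → ℝ) →L[ℝ] E} {q : Fin n → ℝ}
    (h : HasFDerivAt u u' q) (i : Fin n) : pd i u q = u' (Pi.single i 1) := by
  rw [pd, h.fderiv]

section rules
variable {n : ℕ} {u v : (Fin n → ℝ) → ℝ} {q : Fin n → ℝ}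

lemma pd_const (i : Fin n) (c : ℝ) : pd i (fun _ => c) q = 0 := by simp [pd]

lemma pd_coord (i j : Fin n) : pd i (fun x => x j) q = if j = i then 1 else 0 := by
  have : HasFDerivAt (fun x : Fin n → ℝ => x j) (ContinuousLinearMap.proj (R := ℝ) j) q :=
    hasFDerivAt_apply j q
  rw [pd_eq_of_hasFDerivAt this]
  simp [Pi.single_apply]

lemma pd_add (i : Fin n) (hu : DifferentiableAt ℝ u q) (hv : DifferentiableAt ℝ v q) :
    pd i (fun x => u x + v x) q = pd i u q + pd i v q := by
  simp [pd, fderiv_fun_add hu hv]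

lemma pd_sub (i : Fin n) (hu : DifferentiableAt ℝ u q) (hv : DifferentiableAt ℝ v q) :
    pd i (fun x => u x - v x) q = pd i u q - pd i v q := by
  simp [pd, fderiv_fun_sub hu hv]

lemma pd_neg (i : Fin n) : pd i (fun x => -u x) q = -pd i u q := by
  simp [pd, fderiv_fun_neg]

lemma pd_mul (i : Fin n) (hu : DifferentiableAt ℝ u q) (hv : DifferentiableAt ℝ v q) :
    pd i (fun x => u x * v x) q = pd i u q * v q + u q * pd i v q := by
  simp [pd, fderiv_fun_mul hu hv]; ring

lemma pd_div_const (i : Fin n) (hu : DifferentiableAt ℝ u q) (c : ℝ) :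
    pd i (fun x => u x / c) q = pd i u q / c := by
  simp only [div_eq_mul_inv]
  rw [pd_mul i hu (by fun_prop), pd_const]; ring

/-- Partial derivative of a function of one coordinate. -/
lemma pd_comp_coord {φ : ℝ → ℝ} {φ' : ℝ} (i j : Fin n) (h : HasDerivAt φ φ' (q j)) :
    pd i (fun x => φ (x j)) q = if j = i then φ' else 0 := by
  have h1 : HasFDerivAt (fun x : Fin n → ℝ => x j) (ContinuousLinearMap.proj (R := ℝ) j) q :=
    hasFDerivAt_apply j q
  rw [show (fun x : Fin n → ℝ => φ (x j)) = φ ∘ fun x => x j from rfl,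
    pd_eq_of_hasFDerivAt (h.comp_hasFDerivAt q h1)]
  simp [Pi.single_apply]

lemma pd_pi {m : ℕ} {Φ : (Fin n → ℝ) → Fin m → ℝ} (hΦ : DifferentiableAt ℝ Φ q) (i : Fin n)
    (k : Fin m) : pd i Φ q k = pd i (fun x => Φ x k) q := by
  simp only [pd]
  rw [fderiv_pi (differentiableAt_pi.1 hΦ)]
  rfl

end rules

/-! ### Curvature of `Nil₃` -/

/-- The coefficients of the contact form `dz + (y dx - x dy)/2`. -/
def contactCoeff (p : Nil) : Fin 3 → ℝ := ![p 1 / 2, -(p 0 / 2), 1]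

lemma nilMetric_eq : nilMetric = fun p => !![1 + p 1 ^ 2 / 4, -(p 0 * p 1) / 4, p 1 / 2;
    -(p 0 * p 1) / 4, 1 + p 0 ^ 2 / 4, -p 0 / 2; p 1 / 2, -p 0 / 2, 1] := by
  ext p i j
  fin_cases i <;> fin_cases j <;> simp [nilMetric, nilInner] <;> ring

lemma nilMetric_inv (p : Nil) : (nilMetric p)⁻¹ = !![1, 0, -p 1 / 2; 0, 1, p 0 / 2;
    -p 1 / 2, p 0 / 2, 1 + (p 0 ^ 2 + p 1 ^ 2) / 4] := by
  apply Matrix.inv_eq_right_inv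
  rw [nilMetric_eq]
  ext i j
  fin_cases i <;> fin_cases j <;> simp [Matrix.mul_apply, Fin.sum_univ_three] <;> ring

lemma pd_nilMetric (l i j : Fin 3) (p : Nil) :
    pd l (fun x => nilMetric x i j) p =
      ![-((if i = 1 then contactCoeff p j else 0) + (if j = 1 then contactCoeff p i else 0)) / 2,
        ((if i = 0 then contactCoeff p j else 0) + (if j = 0 then contactCoeff p i else 0)) / 2,
        0] l := by
  rw [nilMetric_eq]
  fin_cases i <;> fin_cases j <;> fin_cases l <;>
    simp (disch := fun_prop) [contactCoeff, pd_const, pd_coord, pd_add, pd_mul, pd_neg,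
      pd_div_const, pow_two] <;> ring

/-- The Christoffel symbols of `Nil₃`: in the left-invariant frame,
`Γ(v, w) = (v₁ α(w) + w₁ α(v)) X / 2 - (v₀ α(w) + w₀ α(v)) Y / 2`, with `α` the contact form. -/
lemma christoffel_nilMetric : christoffel nilMetric = fun k i j p =>
    ![((if i = 1 then contactCoeff p j else 0) + (if j = 1 then contactCoeff p i else 0)) / 2,
      -((if i = 0 then contactCoeff p j else 0) + (if j = 0 then contactCoeff p i else 0)) / 2,
      -(p 1 / 2) * (((if i = 1 then contactCoeff p j else 0)
          + (if j = 1 then contactCoeff p i else 0)) / 2)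
        - p 0 / 2 * (((if i = 0 then contactCoeff p j else 0)
          + (if j = 0 then contactCoeff p i else 0)) / 2)] k := by
  funext k i j p
  simp only [christoffel, pd_nilMetric, nilMetric_inv, Fin.sum_univ_three]
  fin_cases k <;> fin_cases i <;> fin_cases j <;>
    simp [contactCoeff] <;> ring

lemma ricci_nilMetric (i j : Fin 3) (p : Nil) : ricci nilMetric i j p =
    (contactCoeff p i * contactCoeff p j
      - ((if i = 0 then 1 else 0) * (if j = 0 then 1 else 0)
        + (if i = 1 then 1 else 0) * (if j = 1 then 1 else 0))) / 2 := by
  simp only [ricci, christoffel_nilMetric, Fin.sum_univ_three]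
  fin_cases i <;> fin_cases j <;>
    simp (disch := fun_prop) [contactCoeff, pd_const, pd_coord, pd_sub, pd_mul, pd_neg,
      pd_div_const] <;> ring

/-- `Ric(v, v)` is half of the squared vertical part of `v` minus half of the squared horizontal
part. -/
lemma nilRic_eq (p v : Nil) : nilRic p v =
    ((v 2 + (p 1 * v 0 - p 0 * v 1) / 2) ^ 2 - (v 0 ^ 2 + v 1 ^ 2)) / 2 := by
  simp [nilRic, ricci_nilMetric, Fin.sum_univ_three, contactCoeff]
  ring

/-! ### The profile equation -/

namespace IsCatenoidProfile

variable {a : ℝ} {g : ℝ → ℝ}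

lemma hasDerivAt (h : IsCatenoidProfile a g) (t : ℝ) : HasDerivAt g (deriv g t) t :=
  (h.contDiff.differentiable (by norm_num) t).hasDerivAt

lemma hasDerivAt_deriv (h : IsCatenoidProfile a g) (t : ℝ) :
    HasDerivAt (deriv g) (deriv (deriv g) t) t := by
  have h2 : ContDiff ℝ (1 + 1) g := by simpa [one_add_one_eq_two] using h.contDiff
  exact ((contDiff_succ_iff_deriv.1 h2).2.2.differentiable (by norm_num) t).hasDerivAt

lemma init_pos (h : IsCatenoidProfile a g) : 0 < a := h.init ▸ h.pos 0

/-- The first integral `(1 + g'²) (g² + 4) / g² = (a² + 4) / a²` of the profile equation. -/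
lemma sq_deriv (h : IsCatenoidProfile a g) (t : ℝ) :
    deriv g t ^ 2 = 4 * (g t ^ 2 - a ^ 2) / (a ^ 2 * (g t ^ 2 + 4)) := by
  have key : ∀ t, HasDerivAt (fun t => (1 + deriv g t ^ 2) * (g t ^ 2 + 4) / g t ^ 2) 0 t := by
    intro t
    have hg := h.hasDerivAt t
    have hg' := h.hasDerivAt_deriv t
    have hp := h.pos t
    have := (((hg'.fun_pow 2).const_add 1).mul ((hg.fun_pow 2).add_const 4)).div (hg.fun_pow 2)
      (by positivity)
    refine this.congr_deriv ?_
    have ode := h.ode t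
    have h2 : deriv (deriv g) t = 4 * (1 + deriv g t ^ 2) / (g t * (g t ^ 2 + 4)) := by
      field_simp
      linarith
    rw [h2]
    field_simp
    simp
    ring
  have hc := is_const_of_deriv_eq_zero (fun t => (key t).differentiableAt)
    (fun t => (key t).deriv) t 0
  have hp := h.pos t
  have ha := h.init_pos
  simp only [h.init, h.init_deriv] at hc
  field_simp at hc ⊢
  linarith

lemma deriv_deriv (h : IsCatenoidProfile a g) (t : ℝ) :
    deriv (deriv g) t = 4 * (a ^ 2 + 4) * g t / (a ^ 2 * (g t ^ 2 + 4) ^ 2) := by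
  have hp := h.pos t
  have ha := h.init_pos
  have h2 : deriv (deriv g) t = 4 * (1 + deriv g t ^ 2) / (g t * (g t ^ 2 + 4)) := by
    have := h.ode t
    field_simp
    linarith
  rw [h2, h.sq_deriv]
  field_simp
  ring

/-- Bootstrapping from `g'' = 4 (a² + 4) g / (a² (g² + 4)²)`. -/
lemma contDiff_infty (h : IsCatenoidProfile a g) : ContDiff ℝ ∞ g := by
  have ha := h.init_pos
  have hd : Differentiable ℝ g := fun t => (h.hasDerivAt t).differentiableAt
  have hd' : Differentiable ℝ (deriv g) := fun t => (h.hasDerivAt_deriv t).differentiableAt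
  have key : ∀ n : ℕ, ContDiff ℝ n g ∧ ContDiff ℝ n (deriv g) := by
    intro n
    induction n with
    | zero => exact ⟨contDiff_zero.2 hd.continuous, contDiff_zero.2 hd'.continuous⟩
    | succ n ih =>
      push_cast
      refine ⟨contDiff_succ_iff_deriv.2 ⟨hd, by simp, ih.2⟩,
        contDiff_succ_iff_deriv.2 ⟨hd', by simp, ?_⟩⟩
      rw [funext h.deriv_deriv]
      have := ih.1
      exact (contDiff_const.mul this).div (by fun_prop) fun t => by positivity
  exact _root_.contDiff_infty.2 fun n => (key n).1

end IsCatenoidProfile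

/-! ### Induced metric, second fundamental form and Jacobi operator -/

section surface

variable {a : ℝ} {g : ℝ → ℝ}

lemma revMap_contDiff {n : WithTop ℕ∞} (hg : ContDiff ℝ n g) : ContDiff ℝ n (revMap g) := by
  rw [contDiff_pi]
  intro k
  have h0 : ContDiff ℝ n (fun q : Fin 2 → ℝ => q 0) := contDiff_apply ℝ ℝ 0
  have h1 : ContDiff ℝ n (fun q : Fin 2 → ℝ => q 1) := contDiff_apply ℝ ℝ 1
  fin_cases k
  · exact (hg.comp h0).mul (Real.contDiff_cos.comp h1)
  · exact (hg.comp h0).mul (Real.contDiff_sin.comp h1)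
  · exact h0

/-- Partial derivatives of a product of functions of the two coordinates. -/
lemma pd_mul_coord {φ ψ : ℝ → ℝ} {φ' ψ' : ℝ} {q : Fin 2 → ℝ} (hφ : HasDerivAt φ φ' (q 0))
    (hψ : HasDerivAt ψ ψ' (q 1)) (i : Fin 2) :
    pd i (fun x => φ (x 0) * ψ (x 1)) q = ![φ' * ψ (q 1), φ (q 0) * ψ'] i := by
  rw [pd_mul (u := fun x => φ (x 0)) (v := fun x => ψ (x 1)) i (hφ.differentiableAt.comp q (differentiableAt_apply 0 q))
    (hψ.differentiableAt.comp q (differentiableAt_apply 1 q)),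
    pd_comp_coord i 0 hφ, pd_comp_coord i 1 hψ]
  fin_cases i <;> simp

namespace IsCatenoidProfile

lemma pd_zero_revMap (h : IsCatenoidProfile a g) : pd 0 (revMap g) = fun q =>
    ![deriv g (q 0) * Real.cos (q 1), deriv g (q 0) * Real.sin (q 1), 1] := by
  funext q k
  rw [pd_pi ((revMap_contDiff h.contDiff).differentiable (by norm_num) q)]
  fin_cases k
  · exact pd_mul_coord (h.hasDerivAt _) (Real.hasDerivAt_cos _) 0
  · exact pd_mul_coord (h.hasDerivAt _) (Real.hasDerivAt_sin _) 0
  · exact pd_coord 0 0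

lemma pd_one_revMap (h : IsCatenoidProfile a g) : pd 1 (revMap g) = fun q =>
    ![g (q 0) * -Real.sin (q 1), g (q 0) * Real.cos (q 1), 0] := by
  funext q k
  rw [pd_pi ((revMap_contDiff h.contDiff).differentiable (by norm_num) q)]
  fin_cases k
  · exact pd_mul_coord (h.hasDerivAt _) (Real.hasDerivAt_cos _) 1
  · exact pd_mul_coord (h.hasDerivAt _) (Real.hasDerivAt_sin _) 1
  · exact pd_coord 1 0

lemma pd_zero_zero_revMap (h : IsCatenoidProfile a g) (q : Fin 2 → ℝ) : pd 0 (pd 0 (revMap g)) q =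
    ![deriv (deriv g) (q 0) * Real.cos (q 1), deriv (deriv g) (q 0) * Real.sin (q 1), 0] := by
  funext k
  rw [h.pd_zero_revMap, pd_pi]
  · fin_cases k
    · exact pd_mul_coord (h.hasDerivAt_deriv _) (Real.hasDerivAt_cos _) 0
    · exact pd_mul_coord (h.hasDerivAt_deriv _) (Real.hasDerivAt_sin _) 0
    · exact pd_const 0 1
  · have hd : Differentiable ℝ (deriv g) := fun t => (h.hasDerivAt_deriv t).differentiableAt
    rw [differentiableAt_pi]
    intro k
    fin_cases k <;> simp <;> fun_prop

lemma pd_one_zero_revMap (h : IsCatenoidProfile a g) (q : Fin 2 → ℝ) : pd 1 (pd 0 (revMap g)) q =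
    ![deriv g (q 0) * -Real.sin (q 1), deriv g (q 0) * Real.cos (q 1), 0] := by
  funext k
  rw [h.pd_zero_revMap, pd_pi]
  · fin_cases k
    · exact pd_mul_coord (h.hasDerivAt_deriv _) (Real.hasDerivAt_cos _) 1
    · exact pd_mul_coord (h.hasDerivAt_deriv _) (Real.hasDerivAt_sin _) 1
    · exact pd_const 1 1
  · have hd : Differentiable ℝ (deriv g) := fun t => (h.hasDerivAt_deriv t).differentiableAt
    rw [differentiableAt_pi]
    intro k
    fin_cases k <;> simp <;> fun_prop

lemma differentiableAt_pd_one_revMap (h : IsCatenoidProfile a g) (q : Fin 2 → ℝ) :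
    DifferentiableAt ℝ (pd 1 (revMap g)) q := by
  have hd : Differentiable ℝ g := fun t => (h.hasDerivAt t).differentiableAt
  rw [h.pd_one_revMap, differentiableAt_pi]
  intro k
  fin_cases k <;> simp <;> fun_prop

lemma pd_zero_one_revMap (h : IsCatenoidProfile a g) (q : Fin 2 → ℝ) : pd 0 (pd 1 (revMap g)) q =
    ![deriv g (q 0) * -Real.sin (q 1), deriv g (q 0) * Real.cos (q 1), 0] := by
  funext k
  rw [pd_pi (h.differentiableAt_pd_one_revMap q), h.pd_one_revMap]
  fin_cases k
  · exact pd_mul_coord (h.hasDerivAt _) (Real.hasDerivAt_sin _).fun_neg 0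
  · exact pd_mul_coord (h.hasDerivAt _) (Real.hasDerivAt_cos _) 0
  · exact pd_const 0 0

lemma pd_one_one_revMap (h : IsCatenoidProfile a g) (q : Fin 2 → ℝ) : pd 1 (pd 1 (revMap g)) q =
    ![g (q 0) * -Real.cos (q 1), g (q 0) * -Real.sin (q 1), 0] := by
  funext k
  rw [pd_pi (h.differentiableAt_pd_one_revMap q), h.pd_one_revMap]
  fin_cases k
  · exact pd_mul_coord (h.hasDerivAt _) (Real.hasDerivAt_sin _).fun_neg 1
  · exact pd_mul_coord (h.hasDerivAt _) (Real.hasDerivAt_cos _) 1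
  · exact pd_const 1 0

lemma firstFF_eq (h : IsCatenoidProfile a g) (q : Fin 2 → ℝ) : firstFF (revMap g) q =
    !![1 + deriv g (q 0) ^ 2, -g (q 0) ^ 2 / 2; -g (q 0) ^ 2 / 2,
      g (q 0) ^ 2 + g (q 0) ^ 4 / 4] := by
  -- even powers of `sin θ` are eliminated so that `ring` sees a unique normal form
  have hs := Real.sin_sq_add_cos_sq (q 1)
  have hs' : Real.sin (q 1) ^ 2 = 1 - Real.cos (q 1) ^ 2 := by linarith
  have hs4 : Real.sin (q 1) ^ 4 = (1 - Real.cos (q 1) ^ 2) ^ 2 := by rw [← hs']; ring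
  ext i j
  fin_cases i <;> fin_cases j <;>
    simp [firstFF, nilInner, h.pd_zero_revMap, h.pd_one_revMap, revMap] <;>
    ring_nf <;> simp only [hs', hs4] <;> ring

/-- By the first integral, the normalizing factor of the normal is `W = a / g`. -/
lemma one_add_sq (h : IsCatenoidProfile a g) (t : ℝ) :
    1 + deriv g t ^ 2 + g t ^ 2 * deriv g t ^ 2 / 4 = (g t / a) ^ 2 := by
  have ha := h.init_pos
  rw [h.sq_deriv]
  field_simp
  ring

lemma det_firstFF (h : IsCatenoidProfile a g) (q : Fin 2 → ℝ) :
    (firstFF (revMap g) q).det = (g (q 0) ^ 2 / a) ^ 2 := by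
  have := h.one_add_sq (q 0)
  rw [h.firstFF_eq, Matrix.det_fin_two_of]
  calc _ = g (q 0) ^ 2 * (1 + deriv g (q 0) ^ 2 + g (q 0) ^ 2 * deriv g (q 0) ^ 2 / 4) := by ring
    _ = _ := by rw [this]; ring

lemma areaDensity_eq (h : IsCatenoidProfile a g) (q : Fin 2 → ℝ) :
    areaDensity (revMap g) q = g (q 0) ^ 2 / a := by
  have ha := h.init_pos
  rw [areaDensity, h.det_firstFF, Real.sqrt_sq (by positivity)]

lemma firstFF_inv (h : IsCatenoidProfile a g) (q : Fin 2 → ℝ) : (firstFF (revMap g) q)⁻¹ =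
    !![a ^ 2 * (g (q 0) ^ 2 + 4) / (4 * g (q 0) ^ 2), a ^ 2 / (2 * g (q 0) ^ 2);
      a ^ 2 / (2 * g (q 0) ^ 2), (a ^ 2 + 4) / (g (q 0) ^ 2 * (g (q 0) ^ 2 + 4))] := by
  have ha := h.init_pos
  have hp := h.pos (q 0)
  apply Matrix.inv_eq_right_inv
  rw [h.firstFF_eq, h.sq_deriv]
  ext i j
  fin_cases i <;> fin_cases j <;> simp [Matrix.mul_apply, Fin.sum_univ_two] <;> field_simp <;> ring

/-- The product of a vector with the unit normal, whose normalizing factor is `W = a / g`. -/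
lemma nilInner_revNormal (h : IsCatenoidProfile a g) (q : Fin 2 → ℝ) (v : Nil) :
    nilInner (revMap g q) v (revNormal g q) = a / g (q 0) *
      (v 0 * (-Real.cos (q 1) - g (q 0) * deriv g (q 0) * Real.sin (q 1) / 2)
        + v 1 * (-Real.sin (q 1) + g (q 0) * deriv g (q 0) * Real.cos (q 1) / 2)
        + (v 2 + (g (q 0) * Real.sin (q 1) * v 0 - g (q 0) * Real.cos (q 1) * v 1) / 2)
          * deriv g (q 0)) := by
  have ha := h.init_pos
  have hp := h.pos (q 0)
  simp [nilInner, revNormal, h.one_add_sq, Real.sqrt_sq (div_pos hp ha).le, frameX, frameY, frameZ,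
    revMap]
  ring

lemma secondFF_zero_zero (h : IsCatenoidProfile a g) (q : Fin 2 → ℝ) :
    secondFF (revMap g) (revNormal g) 0 0 q = a / g (q 0) *
      (-deriv (deriv g) (q 0) - g (q 0) * deriv g (q 0) ^ 2 / 2) := by
  have hs := Real.sin_sq_add_cos_sq (q 1)
  have hs' : Real.sin (q 1) ^ 2 = 1 - Real.cos (q 1) ^ 2 := by linarith
  rw [secondFF, h.nilInner_revNormal, h.pd_zero_zero_revMap, h.pd_zero_revMap]
  congr 1
  simp [Fin.sum_univ_three, christoffel_nilMetric, contactCoeff, revMap]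
  ring_nf
  simp only [hs']
  ring

lemma secondFF_zero_one (h : IsCatenoidProfile a g) (q : Fin 2 → ℝ) :
    secondFF (revMap g) (revNormal g) 0 1 q = a / g (q 0) *
      (g (q 0) ^ 3 * deriv g (q 0) ^ 2 / 8 - g (q 0) / 2) := by
  have hs := Real.sin_sq_add_cos_sq (q 1)
  have hs' : Real.sin (q 1) ^ 2 = 1 - Real.cos (q 1) ^ 2 := by linarith
  have hs4 : Real.sin (q 1) ^ 4 = (1 - Real.cos (q 1) ^ 2) ^ 2 := by rw [← hs']; ring
  rw [secondFF, h.nilInner_revNormal, h.pd_zero_one_revMap, h.pd_zero_revMap, h.pd_one_revMap]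
  congr 1
  simp [Fin.sum_univ_three, christoffel_nilMetric, contactCoeff, revMap]
  ring_nf
  simp only [hs', hs4]
  ring

lemma secondFF_one_zero (h : IsCatenoidProfile a g) (q : Fin 2 → ℝ) :
    secondFF (revMap g) (revNormal g) 1 0 q = a / g (q 0) *
      (g (q 0) ^ 3 * deriv g (q 0) ^ 2 / 8 - g (q 0) / 2) := by
  have hs := Real.sin_sq_add_cos_sq (q 1)
  have hs' : Real.sin (q 1) ^ 2 = 1 - Real.cos (q 1) ^ 2 := by linarith
  have hs4 : Real.sin (q 1) ^ 4 = (1 - Real.cos (q 1) ^ 2) ^ 2 := by rw [← hs']; ring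
  rw [secondFF, h.nilInner_revNormal, h.pd_one_zero_revMap, h.pd_zero_revMap, h.pd_one_revMap]
  congr 1
  simp [Fin.sum_univ_three, christoffel_nilMetric, contactCoeff, revMap]
  ring_nf
  simp only [hs', hs4]
  ring

lemma secondFF_one_one (h : IsCatenoidProfile a g) (q : Fin 2 → ℝ) :
    secondFF (revMap g) (revNormal g) 1 1 q = a / g (q 0) *
      (g (q 0) + g (q 0) ^ 3 / 2) := by
  have hs := Real.sin_sq_add_cos_sq (q 1)
  have hs' : Real.sin (q 1) ^ 2 = 1 - Real.cos (q 1) ^ 2 := by linarith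
  have hs4 : Real.sin (q 1) ^ 4 = (1 - Real.cos (q 1) ^ 2) ^ 2 := by rw [← hs']; ring
  rw [secondFF, h.nilInner_revNormal, h.pd_one_one_revMap, h.pd_one_revMap]
  congr 1
  simp [Fin.sum_univ_three, christoffel_nilMetric, contactCoeff, revMap]
  ring_nf
  simp only [hs', hs4]
  ring

lemma nilRic_revNormal (h : IsCatenoidProfile a g) (q : Fin 2 → ℝ) :
    nilRic (revMap g q) (revNormal g q) = (a * deriv g (q 0) / g (q 0)) ^ 2 - 1 / 2 := by
  have ha := h.init_pos
  have hp := h.pos (q 0)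
  have hs := Real.sin_sq_add_cos_sq (q 1)
  have hs' : Real.sin (q 1) ^ 2 = 1 - Real.cos (q 1) ^ 2 := by linarith
  rw [nilRic_eq]
  simp [revNormal, h.one_add_sq, Real.sqrt_sq (div_pos hp ha).le, frameX, frameY, frameZ, revMap]
  ring_nf
  simp only [hs']
  ring_nf
  rw [h.sq_deriv]
  field_simp
  ring

/-- The potential `|A|² + Ric(N, N)` of the Jacobi operator. -/
lemma potential_eq (h : IsCatenoidProfile a g) (q : Fin 2 → ℝ) :
    normSqA (revMap g) (revNormal g) q + nilRic (revMap g q) (revNormal g q) =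
      2 * (a ^ 2 + 4) / (g (q 0) ^ 2 + 4) ^ 2 + 2 * a ^ 2 / g (q 0) ^ 4 := by
  have ha := h.init_pos
  have hp := h.pos (q 0)
  rw [h.nilRic_revNormal, div_pow, mul_pow]
  simp only [normSqA, Fin.sum_univ_two, h.firstFF_inv, h.secondFF_zero_zero, h.secondFF_zero_one,
    h.secondFF_one_zero, h.secondFF_one_one, h.sq_deriv, h.deriv_deriv]
  simp
  field_simp
  ring

end IsCatenoidProfile
end surface

section

/-! ### The Jacobi operator in the parameters -/

/-- The coefficient `p` of `∂t²` in `D · Δ`, where `D` is the area density. The mixed coefficient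
is the constant `a / 2`. -/
def fluxCoeff (a : ℝ) (g : ℝ → ℝ) (t : ℝ) : ℝ := a * (g t ^ 2 + 4) / 4

/-- The coefficient of `∂θ²` in `D · Δ`. -/
def angularCoeff (a : ℝ) (g : ℝ → ℝ) (t : ℝ) : ℝ := (a ^ 2 + 4) / (a * (g t ^ 2 + 4))

/-- The potential `|A|² + Ric(N, N)` times the area density. -/
def potentialDensity (a : ℝ) (g : ℝ → ℝ) (t : ℝ) : ℝ :=
  2 * (a ^ 2 + 4) * g t ^ 2 / (a * (g t ^ 2 + 4) ^ 2) + 2 * a / g t ^ 2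

lemma contDiff_pd {n : ℕ} {m : WithTop ℕ∞} {u : (Fin n → ℝ) → ℝ} (hu : ContDiff ℝ (m + 1) u)
    (i : Fin n) : ContDiff ℝ m (pd i u) :=
  (hu.fderiv_right le_rfl).clm_apply contDiff_const

variable {a : ℝ} {g : ℝ → ℝ}

lemma fluxCoeff_pos (ha : 0 < a) (t : ℝ) : 0 < fluxCoeff a g t := by
  unfold fluxCoeff; positivity

/-- The `t`-component of the vector density `D ∇u`. -/
def fluxT (a : ℝ) (g : ℝ → ℝ) (u : (Fin 2 → ℝ) → ℝ) (q : Fin 2 → ℝ) : ℝ :=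
  fluxCoeff a g (q 0) * pd 0 u q + a / 2 * pd 1 u q

/-- The `θ`-component of the vector density `D ∇u`. -/
def fluxTheta (a : ℝ) (g : ℝ → ℝ) (u : (Fin 2 → ℝ) → ℝ) (q : Fin 2 → ℝ) : ℝ :=
  a / 2 * pd 0 u q + angularCoeff a g (q 0) * pd 1 u q

namespace IsCatenoidProfile

lemma contDiff_fluxCoeff (h : IsCatenoidProfile a g) : ContDiff ℝ ∞ (fluxCoeff a g) := by
  have := h.contDiff_infty
  unfold fluxCoeff
  fun_prop

lemma contDiff_angularCoeff (h : IsCatenoidProfile a g) : ContDiff ℝ ∞ (angularCoeff a g) := by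
  have := h.contDiff_infty
  have ha := h.init_pos
  unfold angularCoeff
  exact contDiff_const.div (by fun_prop) fun t => by positivity

lemma contDiff_potentialDensity (h : IsCatenoidProfile a g) :
    ContDiff ℝ ∞ (potentialDensity a g) := by
  have := h.contDiff_infty
  have ha := h.init_pos
  unfold potentialDensity
  refine ContDiff.add (ContDiff.div (by fun_prop) (by fun_prop) fun t => by positivity)
    (contDiff_const.div (by fun_prop) fun t => ?_)
  have := h.pos t
  positivity

lemma jacobiOp_mul_areaDensity (h : IsCatenoidProfile a g) (u : (Fin 2 → ℝ) → ℝ)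
    (q : Fin 2 → ℝ) :
    jacobiOp (revMap g) (revNormal g) u q * areaDensity (revMap g) q =
      -(pd 0 (fluxT a g u) q + pd 1 (fluxTheta a g u) q) - potentialDensity a g (q 0) * u q := by
  have ha := h.init_pos
  have hp := h.pos (q 0)
  have h0 : (fun x => areaDensity (revMap g) x *
      ∑ j, (firstFF (revMap g) x)⁻¹ 0 j * pd j u x) = fluxT a g u := by
    funext x
    have hp := h.pos (x 0)
    simp [h.areaDensity_eq, h.firstFF_inv, Fin.sum_univ_two, fluxT, fluxCoeff]
    field_simp
  have h1 : (fun x => areaDensity (revMap g) x *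
      ∑ j, (firstFF (revMap g) x)⁻¹ 1 j * pd j u x) = fluxTheta a g u := by
    funext x
    have hp := h.pos (x 0)
    simp [h.areaDensity_eq, h.firstFF_inv, Fin.sum_univ_two, fluxTheta, angularCoeff]
    field_simp
  rw [jacobiOp, laplacian, h.potential_eq, Fin.sum_univ_two, h0, h1, h.areaDensity_eq,
    potentialDensity]
  field_simp

end IsCatenoidProfile

/-! ### Rotationally invariant Jacobi fields -/

/-- `w` is a rotationally invariant Jacobi field with flux `P = p w'`: the equation
`(p w')' + κ w = 0` as a first-order system. -/
structure IsJacobiPair (a : ℝ) (g w P : ℝ → ℝ) : Prop where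
  hasDerivAt : ∀ t, HasDerivAt w (P t / fluxCoeff a g t) t
  hasDerivAt_flux : ∀ t, HasDerivAt P (-(potentialDensity a g t * w t)) t

lemma fluxT_comp {E E' : ℝ → ℝ} (hE : ∀ t, HasDerivAt E (E' t) t) :
    fluxT a g (fun q => E (q 0)) = fun q => fluxCoeff a g (q 0) * E' (q 0) := by
  funext q
  simp [fluxT, pd_comp_coord 0 0 (hE (q 0)), pd_comp_coord 1 0 (hE (q 0))]

lemma fluxTheta_comp {E E' : ℝ → ℝ} (hE : ∀ t, HasDerivAt E (E' t) t) :
    fluxTheta a g (fun q => E (q 0)) = fun q => a / 2 * E' (q 0) := by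
  funext q
  simp [fluxTheta, pd_comp_coord 0 0 (hE (q 0)), pd_comp_coord 1 0 (hE (q 0))]

/-- No differentiability is needed: the junk value of `fderiv` is also zero. -/
lemma pd_one_comp_coord_zero (E : ℝ → ℝ) (q : Fin 2 → ℝ) : pd 1 (fun x => E (x 0)) q = 0 := by
  by_cases hd : DifferentiableAt ℝ (fun x : Fin 2 → ℝ => E (x 0)) q
  · have h1 : HasDerivAt (fun s : ℝ => q + s • (Pi.single 1 1 : Fin 2 → ℝ)) (Pi.single 1 1) 0 := by
      simpa using ((hasDerivAt_id (0 : ℝ)).smul_const (Pi.single 1 1 : Fin 2 → ℝ)).const_add q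
    have h2 := HasFDerivAt.comp_hasDerivAt_of_eq (0 : ℝ) hd.hasFDerivAt h1 (by simp)
    have h3 : ((fun x : Fin 2 → ℝ => E (x 0)) ∘
        fun s : ℝ => q + s • (Pi.single 1 1 : Fin 2 → ℝ)) = fun _ => E (q 0) := by
      funext s; simp
    rw [h3] at h2
    exact h2.unique (hasDerivAt_const _ _)
  · simp [pd, fderiv_zero_of_not_differentiableAt hd]

/-- The Jacobi operator on rotationally invariant functions: `D · J E = -(p E')' - κ E`. -/
lemma IsCatenoidProfile.jacobiOp_comp (h : IsCatenoidProfile a g) {E E' F' : ℝ → ℝ}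
    (hE : ∀ t, HasDerivAt E (E' t) t)
    (hF : ∀ t, HasDerivAt (fun t => fluxCoeff a g t * E' t) (F' t) t) (q : Fin 2 → ℝ) :
    jacobiOp (revMap g) (revNormal g) (fun q => E (q 0)) q * areaDensity (revMap g) q =
      -F' (q 0) - potentialDensity a g (q 0) * E (q 0) := by
  rw [h.jacobiOp_mul_areaDensity, fluxT_comp hE, fluxTheta_comp hE,
    pd_one_comp_coord_zero (fun t => a / 2 * E' t) q,
    pd_comp_coord (φ := fun t => fluxCoeff a g t * E' t) 0 0 (hF (q 0))]
  simp

namespace IsJacobiPair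

variable {w P : ℝ → ℝ}

lemma jacobiOp_eq_zero (hw : IsJacobiPair a g w P) (h : IsCatenoidProfile a g) (q : Fin 2 → ℝ) :
    jacobiOp (revMap g) (revNormal g) (fun q => w (q 0)) q = 0 := by
  have ha := h.init_pos
  have hp := h.pos (q 0)
  have h1 := h.jacobiOp_comp hw.hasDerivAt (F' := fun t => -(potentialDensity a g t * w t))
    (fun t => by
      convert! hw.hasDerivAt_flux t using 1
      funext s
      have := fluxCoeff_pos (g := g) ha s
      field_simp) q
  rw [h.areaDensity_eq] at h1
  have h2 : g (q 0) ^ 2 / a ≠ 0 := by positivity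
  refine (mul_eq_zero.1 (h1.trans ?_)).resolve_right h2
  ring

lemma add_const_mul {v Q : ℝ → ℝ} (hv : IsJacobiPair a g v Q) (hw : IsJacobiPair a g w P) (c : ℝ) :
    IsJacobiPair a g (fun t => v t + c * w t) (fun t => Q t + c * P t) where
  hasDerivAt t := ((hv.hasDerivAt t).add ((hw.hasDerivAt t).const_mul c)).congr_deriv (by ring)
  hasDerivAt_flux t :=
    ((hv.hasDerivAt_flux t).add ((hw.hasDerivAt_flux t).const_mul c)).congr_deriv (by ring)

lemma contDiff_infty (hw : IsJacobiPair a g w P) (h : IsCatenoidProfile a g) :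
    ContDiff ℝ ∞ w := by
  have ha := h.init_pos
  have hd : Differentiable ℝ w := fun t => (hw.hasDerivAt t).differentiableAt
  have hd' : Differentiable ℝ P := fun t => (hw.hasDerivAt_flux t).differentiableAt
  have key : ∀ n : ℕ, ContDiff ℝ n w ∧ ContDiff ℝ n P := by
    intro n
    induction n with
    | zero => exact ⟨contDiff_zero.2 hd.continuous, contDiff_zero.2 hd'.continuous⟩
    | succ n ih =>
      push_cast
      refine ⟨contDiff_succ_iff_deriv.2 ⟨hd, by simp, ?_⟩,
        contDiff_succ_iff_deriv.2 ⟨hd', by simp, ?_⟩⟩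
      · rw [funext fun t => (hw.hasDerivAt t).deriv]
        exact ih.2.div (h.contDiff_fluxCoeff.of_le (mod_cast le_top))
          fun t => (fluxCoeff_pos ha t).ne'
      · rw [funext fun t => (hw.hasDerivAt_flux t).deriv]
        exact ((h.contDiff_potentialDensity.of_le (mod_cast le_top)).mul ih.1).neg
  exact _root_.contDiff_infty.2 fun n => (key n).1

end IsJacobiPair

/-- The Jacobi field `⟨∂z, N⟩ = a g' / g` of the vertical translations. -/
def verticalField (a : ℝ) (g : ℝ → ℝ) (t : ℝ) : ℝ := a * deriv g t / g t

/-- The flux `p φ'` of the vertical field `φ`. -/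
def verticalFlux (a : ℝ) (g : ℝ → ℝ) (t : ℝ) : ℝ :=
  (a ^ 2 + 4) / (g t ^ 2 + 4) + a ^ 2 / g t ^ 2 - 1

/-- The integral `τ(t) = ∫₀ᵗ 2 (g² + 2) / (a (g² + 4))`, for which `1 - φ τ` is the Jacobi field
of the variation of the parameter. -/
def parameterShift (a : ℝ) (g : ℝ → ℝ) (t : ℝ) : ℝ :=
  ∫ s in (0 : ℝ)..t, 2 * (g s ^ 2 + 2) / (a * (g s ^ 2 + 4))

/-- The Jacobi field `e = 1 - φ τ`; `variationJacobi_profile` identifies it with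
`-⟨∂F/∂a, N⟩`. -/
def parameterField (a : ℝ) (g : ℝ → ℝ) (t : ℝ) : ℝ :=
  1 - verticalField a g t * parameterShift a g t

/-- The flux `p e'` of the field `e`. -/
def parameterFlux (a : ℝ) (g : ℝ → ℝ) (t : ℝ) : ℝ :=
  -(verticalFlux a g t * parameterShift a g t) - verticalField a g t * ((g t ^ 2 + 2) / 2)

namespace IsCatenoidProfile

lemma isJacobiPair_vertical (h : IsCatenoidProfile a g) :
    IsJacobiPair a g (verticalField a g) (verticalFlux a g) where
  hasDerivAt t := by
    have hp := h.pos t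
    have ha := h.init_pos
    refine (((h.hasDerivAt_deriv t).const_mul a).div (h.hasDerivAt t) hp.ne').congr_deriv ?_
    have h1 := h.sq_deriv t
    rw [show a * deriv g t * deriv g t = a * deriv g t ^ 2 by ring, h1, h.deriv_deriv, fluxCoeff, verticalFlux]
    field_simp
    ring
  hasDerivAt_flux t := by
    have hp := h.pos t
    have ha := h.init_pos
    have hg := h.hasDerivAt t
    have h2 : g t ^ 2 + 4 ≠ 0 := by positivity
    refine ((((hasDerivAt_const t (a ^ 2 + 4)).div ((hg.fun_pow 2).add_const 4) h2).add
      ((hasDerivAt_const t (a ^ 2)).div (hg.fun_pow 2) (by positivity))).sub_const 1).congr_deriv ?_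
    rw [verticalField, potentialDensity]
    field_simp
    simp
    ring

lemma hasDerivAt_parameterShift (h : IsCatenoidProfile a g) (t : ℝ) :
    HasDerivAt (parameterShift a g) (2 * (g t ^ 2 + 2) / (a * (g t ^ 2 + 4))) t := by
  have ha := h.init_pos
  have hc : Continuous fun s => 2 * (g s ^ 2 + 2) / (a * (g s ^ 2 + 4)) := by
    have := h.contDiff.continuous
    exact Continuous.div (by fun_prop) (by fun_prop) fun s => by positivity
  exact intervalIntegral.integral_hasDerivAt_right (hc.intervalIntegrable _ _)
    hc.stronglyMeasurable.stronglyMeasurableAtFilter hc.continuousAt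

lemma isJacobiPair_parameter (h : IsCatenoidProfile a g) :
    IsJacobiPair a g (parameterField a g) (parameterFlux a g) where
  hasDerivAt t := by
    have hp := h.pos t
    have ha := h.init_pos
    refine (((h.isJacobiPair_vertical.hasDerivAt t).mul
      (h.hasDerivAt_parameterShift t)).const_sub 1).congr_deriv ?_
    rw [fluxCoeff, parameterFlux]
    field_simp
    ring
  hasDerivAt_flux t := by
    have hp := h.pos t
    have ha := h.init_pos
    have hv := h.isJacobiPair_vertical
    refine (((hv.hasDerivAt_flux t).mul (h.hasDerivAt_parameterShift t)).neg.sub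
      ((hv.hasDerivAt t).mul ((((h.hasDerivAt t).fun_pow 2).add_const 2).div_const 2))).congr_deriv
      ?_
    have key : verticalField a g t * (g t * deriv g t) =
        4 * (g t ^ 2 - a ^ 2) / (a * (g t ^ 2 + 4)) := by
      have : verticalField a g t * (g t * deriv g t) = a * deriv g t ^ 2 := by
        rw [verticalField]; field_simp
      rw [this, h.sq_deriv]; field_simp
    have e1 : verticalField a g t * ((2 : ℕ) * g t ^ (2 - 1) * deriv g t / 2) =
        4 * (g t ^ 2 - a ^ 2) / (a * (g t ^ 2 + 4)) := by
      rw [← key]; push_cast; ring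
    rw [e1, parameterField, fluxCoeff]
    simp only [verticalFlux, potentialDensity]
    field_simp
    ring

/-- The Wronskian of the two Jacobi fields is `-1`. -/
lemma wronskian (h : IsCatenoidProfile a g) (t : ℝ) :
    verticalField a g t * parameterFlux a g t - parameterField a g t * verticalFlux a g t = -1 := by
  have hp := h.pos t
  have ha := h.init_pos
  have key : verticalField a g t ^ 2 = 4 * (g t ^ 2 - a ^ 2) / (g t ^ 2 * (g t ^ 2 + 4)) := by
    rw [verticalField, div_pow, mul_pow, h.sq_deriv]; field_simp
  have : verticalField a g t ^ 2 * ((g t ^ 2 + 2) / 2) + verticalFlux a g t = 1 := by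
    rw [key, verticalFlux]; field_simp; ring
  simp only [parameterField, parameterFlux]
  linear_combination -this

lemma deriv_pos (h : IsCatenoidProfile a g) {t : ℝ} (ht : 0 < t) : 0 < deriv g t := by
  have hm : StrictMono (deriv g) := strictMono_of_deriv_pos fun s => by
    have hp := h.pos s
    have ha := h.init_pos
    rw [h.deriv_deriv]; positivity
  simpa [h.init_deriv] using hm ht

lemma verticalField_pos (h : IsCatenoidProfile a g) {t : ℝ} (ht : 0 < t) :
    0 < verticalField a g t :=
  div_pos (mul_pos h.init_pos (h.deriv_pos ht)) (h.pos t)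

lemma verticalField_zero (h : IsCatenoidProfile a g) : verticalField a g 0 = 0 := by
  simp [verticalField, h.init_deriv]

lemma parameterField_zero : parameterField a g 0 = 1 := by
  simp [parameterField, parameterShift]

lemma hasDerivAt_ratio (h : IsCatenoidProfile a g) {t : ℝ} (ht : 0 < t) :
    HasDerivAt (fun t => parameterField a g t / verticalField a g t)
      (-1 / (fluxCoeff a g t * verticalField a g t ^ 2)) t := by
  have hv := h.verticalField_pos ht
  have hf := fluxCoeff_pos (g := g) h.init_pos t
  refine ((h.isJacobiPair_parameter.hasDerivAt t).div (h.isJacobiPair_vertical.hasDerivAt t)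
    hv.ne').congr_deriv ?_
  have := h.wronskian t
  field_simp
  linarith

lemma strictAntiOn_ratio (h : IsCatenoidProfile a g) :
    StrictAntiOn (fun t => parameterField a g t / verticalField a g t) (Set.Ioi 0) := by
  apply strictAntiOn_of_deriv_neg (convex_Ioi 0)
  · exact fun t ht => (h.hasDerivAt_ratio ht).continuousAt.continuousWithinAt
  · intro t ht
    rw [interior_Ioi] at ht
    rw [(h.hasDerivAt_ratio ht).deriv]
    have hv := h.verticalField_pos ht
    have hf := fluxCoeff_pos (g := g) h.init_pos t
    exact div_neg_of_neg_of_pos (by norm_num) (by positivity)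

/-- Since `p φ² ≤ a`, the ratio `e / φ` decreases at least linearly. -/
lemma deriv_ratio_le (h : IsCatenoidProfile a g) {t : ℝ} (ht : 0 < t) :
    -1 / (fluxCoeff a g t * verticalField a g t ^ 2) ≤ -1 / a := by
  have hp := h.pos t
  have ha := h.init_pos
  have hv := h.verticalField_pos ht
  have hf := fluxCoeff_pos (g := g) h.init_pos t
  have : fluxCoeff a g t * verticalField a g t ^ 2 ≤ a := by
    have : fluxCoeff a g t * verticalField a g t ^ 2 = a * (1 - a ^ 2 / g t ^ 2) := by
      rw [fluxCoeff, verticalField, div_pow, mul_pow, h.sq_deriv]; field_simp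
    rw [this]
    have : 0 ≤ a ^ 2 / g t ^ 2 := by positivity
    nlinarith
  rw [neg_div, neg_div, neg_le_neg_iff]
  exact one_div_le_one_div_of_le (by positivity) this

/-- The ratio `e / φ` maps `(0, ∞)` onto `ℝ`. -/
lemma exists_ratio_eq (h : IsCatenoidProfile a g) (c : ℝ) :
    ∃ t, 0 < t ∧ parameterField a g t / verticalField a g t = c := by
  have ha := h.init_pos
  -- large values near `0`, where `e = 1` and `φ = 0`
  obtain ⟨s, hs, hcs⟩ : ∃ s, 0 < s ∧ c ≤ parameterField a g s / verticalField a g s := by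
    have hce : Continuous (parameterField a g) :=
      (h.isJacobiPair_parameter.contDiff_infty h).continuous
    have hcv : Continuous (verticalField a g) :=
      (h.isJacobiPair_vertical.contDiff_infty h).continuous
    have hev : ∀ᶠ s in 𝓝 (0 : ℝ), c * verticalField a g s < parameterField a g s :=
      (hcv.const_mul c).continuousAt.eventually_lt hce.continuousAt
        (by simp [h.verticalField_zero, parameterField_zero])
    have hev' : ∀ᶠ s in 𝓝[>] (0 : ℝ), c * verticalField a g s < parameterField a g s :=
      hev.filter_mono nhdsWithin_le_nhds
    obtain ⟨s, hs, hs'⟩ := (hev'.and self_mem_nhdsWithin).exists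
    exact ⟨s, hs', (le_div_iff₀ (h.verticalField_pos hs')).2 hs.le⟩
  -- small values at infinity, since the derivative is at most `-1 / a`
  obtain ⟨r, hr, hcr⟩ : ∃ r, s ≤ r ∧ parameterField a g r / verticalField a g r ≤ c := by
    set H := fun t => parameterField a g t / verticalField a g t
    refine ⟨s + a * (H s - c), by nlinarith [mul_nonneg ha.le (sub_nonneg.2 hcs)], ?_⟩
    have hle : s ≤ s + a * (H s - c) := by nlinarith [mul_nonneg ha.le (sub_nonneg.2 hcs)]
    have := (convex_Ici s).image_sub_le_mul_sub_of_deriv_le (f := H) (C := -1 / a)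
      (fun t ht => (h.hasDerivAt_ratio (hs.trans_le ht)).continuousAt.continuousWithinAt)
      (fun t ht => by
        rw [interior_Ici] at ht
        exact (h.hasDerivAt_ratio (hs.trans ht)).differentiableAt.differentiableWithinAt)
      (fun t ht => by
        rw [interior_Ici] at ht
        rw [(h.hasDerivAt_ratio (hs.trans ht)).deriv]
        exact h.deriv_ratio_le (hs.trans ht)) s (Set.mem_Ici.2 le_rfl) _ hle hle
    have e : -1 / a * (s + a * (H s - c) - s) = c - H s := by field_simp; ring
    rw [e] at this
    change H _ ≤ c
    linarith
  have := intermediate_value_Icc' hr (f := fun t => parameterField a g t / verticalField a g t)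
    (fun t ht => (h.hasDerivAt_ratio (hs.trans_le ht.1)).continuousAt.continuousWithinAt)
  obtain ⟨t, ht, hte⟩ := this ⟨hcr, hcs⟩
  exact ⟨t, hs.trans_le ht.1, hte⟩

end IsCatenoidProfile

end

section

/-! ### Uniqueness and symmetry of the profile -/

variable {a : ℝ} {g : ℝ → ℝ}

lemma exists_lipschitz_profileField (ha : 0 < a) :
    ∃ K, LipschitzWith K fun x : ℝ => 4 * (a ^ 2 + 4) * x / (a ^ 2 * (x ^ 2 + 4) ^ 2) := by
  have hd : ∀ x : ℝ, HasDerivAt (fun x : ℝ => 4 * (a ^ 2 + 4) * x / (a ^ 2 * (x ^ 2 + 4) ^ 2))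
      (4 * (a ^ 2 + 4) * (4 - 3 * x ^ 2) / (a ^ 2 * (x ^ 2 + 4) ^ 3)) x := by
    intro x
    have hx : a ^ 2 * (x ^ 2 + 4) ^ 2 ≠ 0 := by positivity
    refine (((hasDerivAt_id x).const_mul (4 * (a ^ 2 + 4))).div
      (((((hasDerivAt_id x).fun_pow 2).add_const 4).fun_pow 2).const_mul (a ^ 2)) hx).congr_deriv ?_
    simp only [id]
    field_simp
    simp
    ring
  refine ⟨(12 * (a ^ 2 + 4) / a ^ 2).toNNReal, lipschitzWith_of_nnnorm_deriv_le
    (fun x => (hd x).differentiableAt) fun x => ?_⟩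
  rw [← NNReal.coe_le_coe, coe_nnnorm, Real.coe_toNNReal _ (by positivity), (hd x).deriv,
    Real.norm_eq_abs, abs_div, abs_mul, abs_of_pos (show (0 : ℝ) < 4 * (a ^ 2 + 4) by positivity),
    abs_of_pos (show 0 < a ^ 2 * (x ^ 2 + 4) ^ 3 by positivity),
    div_le_div_iff₀ (by positivity) (by positivity)]
  have h1 : |4 - 3 * x ^ 2| ≤ 3 * (x ^ 2 + 4) := abs_le.2 ⟨by nlinarith, by nlinarith⟩
  have h2 : (x ^ 2 + 4) ≤ (x ^ 2 + 4) ^ 3 := le_self_pow₀ (by nlinarith) (by norm_num)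
  calc 4 * (a ^ 2 + 4) * |4 - 3 * x ^ 2| * a ^ 2 ≤ 4 * (a ^ 2 + 4) * (3 * (x ^ 2 + 4)) * a ^ 2 := by
        gcongr
    _ ≤ 4 * (a ^ 2 + 4) * (3 * (x ^ 2 + 4) ^ 3) * a ^ 2 := by gcongr
    _ = _ := by ring

namespace IsCatenoidProfile

/-- By the first integral, profiles solve an autonomous equation `g'' = K(g)` with `K` globally
Lipschitz, hence are determined by their Cauchy data. -/
lemma unique {g₁ g₂ : ℝ → ℝ} (h₁ : IsCatenoidProfile a g₁) (h₂ : IsCatenoidProfile a g₂) :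
    g₁ = g₂ := by
  obtain ⟨K, hK⟩ := exists_lipschitz_profileField h₁.init_pos
  have hv : LipschitzWith (max 1 K) fun y : ℝ × ℝ =>
      (y.2, 4 * (a ^ 2 + 4) * y.1 / (a ^ 2 * (y.1 ^ 2 + 4) ^ 2)) := by
    have h2 := hK.comp (LipschitzWith.prod_fst (α := ℝ) (β := ℝ))
    rw [mul_one] at h2
    exact LipschitzWith.prod_snd.prodMk h2
  have key := ODE_solution_unique_univ
    (v := fun _ (y : ℝ × ℝ) => (y.2, 4 * (a ^ 2 + 4) * y.1 / (a ^ 2 * (y.1 ^ 2 + 4) ^ 2)))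
    (s := fun _ => Set.univ) (t₀ := 0) (f := fun t => (g₁ t, deriv g₁ t))
    (g := fun t => (g₂ t, deriv g₂ t)) (K := max 1 K)
    (fun t => hv.lipschitzOnWith)
    (fun t => ⟨((h₁.hasDerivAt t).prodMk (h₁.hasDerivAt_deriv t)).congr_deriv
      (by rw [h₁.deriv_deriv]), Set.mem_univ _⟩)
    (fun t => ⟨((h₂.hasDerivAt t).prodMk (h₂.hasDerivAt_deriv t)).congr_deriv
      (by rw [h₂.deriv_deriv]), Set.mem_univ _⟩)
    (by simp [h₁.init, h₂.init, h₁.init_deriv, h₂.init_deriv])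
  funext t
  exact congrArg Prod.fst (congrFun key t)

lemma comp_neg (h : IsCatenoidProfile a g) : IsCatenoidProfile a fun t => g (-t) := by
  have h1 : deriv (fun t => g (-t)) = fun t => -deriv g (-t) := by
    funext t; exact deriv_comp_neg g t
  refine ⟨h.contDiff.comp contDiff_neg, fun t => h.pos _, fun t => ?_, by simpa using h.init,
    by simp [h1, h.init_deriv]⟩
  have h2 : deriv (fun t => -deriv g (-t)) t = deriv (deriv g) (-t) := by
    rw [deriv.fun_neg, deriv_comp_neg, neg_neg]
  rw [h1, h2]
  simpa using h.ode (-t)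

lemma apply_neg (h : IsCatenoidProfile a g) (t : ℝ) : g (-t) = g t :=
  congrFun (h.comp_neg.unique h) t

lemma deriv_neg (h : IsCatenoidProfile a g) (t : ℝ) : deriv g (-t) = -deriv g t := by
  have h1 := deriv_comp_neg g t
  rw [show (fun t => g (-t)) = g from h.comp_neg.unique h] at h1
  linarith

lemma verticalField_neg (h : IsCatenoidProfile a g) (t : ℝ) :
    verticalField a g (-t) = -verticalField a g t := by
  rw [verticalField, verticalField, h.apply_neg, h.deriv_neg]; ring

lemma parameterShift_neg (h : IsCatenoidProfile a g) (t : ℝ) :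
    parameterShift a g (-t) = -parameterShift a g t := by
  have := intervalIntegral.integral_comp_neg (a := 0) (b := t)
    fun s => 2 * (g s ^ 2 + 2) / (a * (g s ^ 2 + 4))
  simp only [h.apply_neg, neg_zero] at this
  rw [parameterShift, parameterShift, this, intervalIntegral.integral_symm]

lemma parameterField_neg (h : IsCatenoidProfile a g) (t : ℝ) :
    parameterField a g (-t) = parameterField a g t := by
  rw [parameterField, parameterField, h.verticalField_neg, h.parameterShift_neg, neg_mul_neg]

end IsCatenoidProfile

/-! ### The family of profiles -/

/-- The speed of `s ↦ t` along the profile, up to the factor `a / 2`, in the parameter `s` for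
which the radius is `a cosh s`. -/
def coshSpeed (a s : ℝ) : ℝ := Real.sqrt (a ^ 2 * Real.cosh s ^ 2 + 4)

/-- The height `t` of the point of the profile with radius `a cosh s`. -/
def height (a s : ℝ) : ℝ := ∫ σ in (0 : ℝ)..s, a / 2 * coshSpeed a σ

/-- The derivative of `height a s` in `a`. -/
def heightParam (a s : ℝ) : ℝ :=
  ∫ σ in (0 : ℝ)..s, (a ^ 2 * Real.cosh σ ^ 2 + 2) / coshSpeed a σ

lemma coshSpeed_pos (a s : ℝ) : 0 < coshSpeed a s := Real.sqrt_pos.2 (by positivity)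

lemma coshSpeed_sq (a s : ℝ) : coshSpeed a s ^ 2 = a ^ 2 * Real.cosh s ^ 2 + 4 :=
  Real.sq_sqrt (by positivity)

lemma continuous_coshSpeed : Continuous fun x : ℝ × ℝ => coshSpeed x.1 x.2 := by
  unfold coshSpeed
  have := Real.continuous_cosh
  fun_prop

lemma continuous_coshSpeed_right (a : ℝ) : Continuous (coshSpeed a) :=
  continuous_coshSpeed.comp (by fun_prop : Continuous fun s : ℝ => (a, s))

lemma hasDerivAt_height (a s : ℝ) : HasDerivAt (height a) (a / 2 * coshSpeed a s) s := by
  have hc : Continuous fun σ => a / 2 * coshSpeed a σ :=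
    continuous_const.mul (continuous_coshSpeed_right a)
  exact intervalIntegral.integral_hasDerivAt_right (hc.intervalIntegrable _ _)
    hc.stronglyMeasurable.stronglyMeasurableAtFilter hc.continuousAt

lemma hasDerivAt_coshSpeed_left (a s : ℝ) :
    HasDerivAt (fun b => b / 2 * coshSpeed b s)
      ((a ^ 2 * Real.cosh s ^ 2 + 2) / coshSpeed a s) a := by
  have h1 : HasDerivAt (fun b : ℝ => b ^ 2 * Real.cosh s ^ 2 + 4) (2 * a * Real.cosh s ^ 2) a := by
    simpa using ((hasDerivAt_pow 2 a).mul_const (Real.cosh s ^ 2)).add_const 4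
  have h2 := h1.sqrt (by positivity)
  have hR := coshSpeed_pos a s
  refine (((hasDerivAt_id a).div_const 2).mul h2).congr_deriv ?_
  change 1 / 2 * coshSpeed a s + a / 2 * (2 * a * Real.cosh s ^ 2 / (2 * coshSpeed a s)) = _
  have := coshSpeed_sq a s
  field_simp
  linarith

lemma continuous_heightParam_integrand :
    Continuous fun x : ℝ × ℝ => (x.1 ^ 2 * Real.cosh x.2 ^ 2 + 2) / coshSpeed x.1 x.2 := by
  have := Real.continuous_cosh
  exact Continuous.div (by fun_prop) continuous_coshSpeed fun x => (coshSpeed_pos _ _).ne'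

lemma hasDerivAt_height_left (a s : ℝ) :
    HasDerivAt (fun b => height b s) (heightParam a s) a := by
  obtain ⟨C, hC⟩ := ((isCompact_closedBall a 1).prod (isCompact_uIcc (a := (0 : ℝ))
    (b := s))).exists_bound_of_continuousOn continuous_heightParam_integrand.continuousOn
  refine (intervalIntegral.hasDerivAt_integral_of_dominated_loc_of_deriv_le
    (F := fun b σ => b / 2 * coshSpeed b σ)
    (F' := fun b σ => (b ^ 2 * Real.cosh σ ^ 2 + 2) / coshSpeed b σ) (bound := fun _ => C)
    (Metric.closedBall_mem_nhds a one_pos) ?_ ?_ ?_ ?_ ?_ ?_).2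
  · exact Filter.Eventually.of_forall fun b =>
      (continuous_const.mul (continuous_coshSpeed_right b)).aestronglyMeasurable
  · exact (continuous_const.mul (continuous_coshSpeed_right a)).intervalIntegrable _ _
  · exact (continuous_heightParam_integrand.comp
      (by fun_prop : Continuous fun σ : ℝ => (a, σ))).aestronglyMeasurable
  · exact Filter.Eventually.of_forall fun σ hσ b hb => hC (b, σ) ⟨hb, Set.uIoc_subset_uIcc hσ⟩
  · exact intervalIntegrable_const
  · exact Filter.Eventually.of_forall fun σ _ b _ => hasDerivAt_coshSpeed_left b σ

lemma continuous_heightParam : Continuous fun x : ℝ × ℝ => heightParam x.1 x.2 := by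
  unfold heightParam
  refine intervalIntegral.continuous_parametric_intervalIntegral_of_continuous
    (f := fun (x : ℝ × ℝ) σ => (x.1 ^ 2 * Real.cosh σ ^ 2 + 2) / coshSpeed x.1 σ) ?_ continuous_snd
  exact continuous_heightParam_integrand.comp
    (by fun_prop : Continuous fun y : (ℝ × ℝ) × ℝ => (y.1.1, y.2))

lemma strictMono_height (ha : 0 < a) : StrictMono (height a) :=
  strictMono_of_deriv_pos fun s => by
    rw [(hasDerivAt_height a s).deriv]
    have := coshSpeed_pos a s
    positivity

lemma height_zero (a : ℝ) : height a 0 = 0 := by simp [height]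

lemma surjective_height (ha : 0 < a) : Function.Surjective (height a) := by
  -- `height a s - a s` is increasing, because `coshSpeed ≥ 2`
  have hm : Monotone fun s => height a s - a * s := by
    have hd : ∀ s, HasDerivAt (fun s => height a s - a * s) (a / 2 * coshSpeed a s - a * 1) s :=
      fun s => (hasDerivAt_height a s).sub ((hasDerivAt_id s).const_mul a)
    refine monotone_of_deriv_nonneg (fun s => (hd s).differentiableAt) fun s => ?_
    rw [(hd s).deriv]
    have : 2 ≤ coshSpeed a s := Real.le_sqrt_of_sq_le (by nlinarith [sq_nonneg (a * Real.cosh s)])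
    nlinarith
  have hc : Continuous (height a) :=
    continuous_iff_continuousAt.2 fun s => (hasDerivAt_height a s).continuousAt
  refine hc.surjective ?_ ?_
  · refine Filter.tendsto_atTop_mono' _ ?_ (Filter.tendsto_id.const_mul_atTop ha)
    filter_upwards [Filter.eventually_ge_atTop 0] with s hs
    have := hm hs
    simp only [height_zero, mul_zero, sub_zero] at this
    simp only [id]
    linarith
  · refine Filter.tendsto_atBot_mono' _ ?_ (Filter.tendsto_id.const_mul_atBot ha)
    filter_upwards [Filter.eventually_le_atBot 0] with s hs
    have := hm hs
    simp only [height_zero, mul_zero, sub_zero] at this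
    simp only [id]
    linarith

/-- The inverse of `height a`. -/
def heightInv (a : ℝ) : ℝ → ℝ := Function.invFun (height a)

lemma height_heightInv (ha : 0 < a) (t : ℝ) : height a (heightInv a t) = t :=
  Function.rightInverse_invFun (surjective_height ha) t

lemma heightInv_height (ha : 0 < a) (s : ℝ) : heightInv a (height a s) = s :=
  Function.leftInverse_invFun (strictMono_height ha).injective s

lemma hasDerivAt_heightInv (ha : 0 < a) (t : ℝ) :
    HasDerivAt (heightInv a) (a / 2 * coshSpeed a (heightInv a t))⁻¹ t := by
  have hc : Continuous (heightInv a) := by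
    have : heightInv a =
        ((strictMono_height ha).orderIsoOfSurjective (height a) (surjective_height ha)).symm := by
      funext t
      apply (strictMono_height ha).injective
      rw [height_heightInv ha]
      exact (((strictMono_height ha).orderIsoOfSurjective (height a)
        (surjective_height ha)).apply_symm_apply t).symm
    rw [this]
    exact OrderIso.continuous _
  have := coshSpeed_pos a (heightInv a t)
  exact HasDerivAt.of_local_left_inverse hc.continuousAt (hasDerivAt_height a _) (by positivity)
    (Filter.Eventually.of_forall (height_heightInv ha))

/-- The implicit function theorem for `height b s = t`. -/
lemma hasDerivAt_heightInv_left (ha : 0 < a) (t : ℝ) :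
    HasDerivAt (fun b => heightInv b t)
      (-(heightParam a (heightInv a t) / (a / 2 * coshSpeed a (heightInv a t)))) a := by
  set s := heightInv a t with hs
  set c := a / 2 * coshSpeed a s with hc
  have hcpos : 0 < c := by have := coshSpeed_pos a s; positivity
  have h2 : (ContinuousLinearMap.toSpanSingleton ℝ c).IsInvertible := by
    refine ⟨ContinuousLinearEquiv.unitsEquivAut ℝ (Units.mk0 c hcpos.ne'), ?_⟩
    ext; simp
  have df₁ : ∀ᶠ v in 𝓝 (a, s), HasFDerivAt (fun b => height b v.2)
      ((fun b s => ContinuousLinearMap.toSpanSingleton ℝ (heightParam b s)) v.1 v.2) v.1 :=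
    Filter.Eventually.of_forall fun v => (hasDerivAt_height_left v.1 v.2).hasFDerivAt
  have df₂ : ∀ᶠ v in 𝓝 (a, s), HasFDerivAt (fun s => height v.1 s)
      ((fun b s => ContinuousLinearMap.toSpanSingleton ℝ (b / 2 * coshSpeed b s)) v.1 v.2) v.2 :=
    Filter.Eventually.of_forall fun v => (hasDerivAt_height v.1 v.2).hasFDerivAt
  have hspan : Continuous fun x : ℝ => ContinuousLinearMap.toSpanSingleton ℝ x :=
    (ContinuousLinearMap.toSpanSingletonCLE (𝕜 := ℝ) (E := ℝ)).continuous
  have cf₁ : ContinuousAt (↿fun b s => ContinuousLinearMap.toSpanSingleton ℝ (heightParam b s))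
      (a, s) := (hspan.comp continuous_heightParam).continuousAt
  have cf₂ : ContinuousAt
      (↿fun b s => ContinuousLinearMap.toSpanSingleton ℝ (b / 2 * coshSpeed b s)) (a, s) :=
    (hspan.comp ((continuous_fst.div_const 2).mul continuous_coshSpeed)).continuousAt
  have hd := (hasStrictFDerivAt_implicitFunctionOfBivariate df₁ df₂ cf₁ cf₂ h2).hasFDerivAt.hasDerivAt
  have hev := eventually_apply_implicitFunctionOfBivariate df₁ df₂ cf₁ cf₂ h2
  have heq : (fun b => heightInv b t) =ᶠ[𝓝 a] implicitFunctionOfBivariate df₁ df₂ cf₁ cf₂ h2 := by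
    filter_upwards [hev, lt_mem_nhds ha] with b hb hb0
    have hb' := hb.trans (height_heightInv ha t)
    rw [← heightInv_height hb0 (implicitFunctionOfBivariate df₁ df₂ cf₁ cf₂ h2 b), hb']
  refine (hd.congr_of_eventuallyEq heq).congr_deriv ?_
  have hinv : ∀ x : ℝ, (ContinuousLinearMap.toSpanSingleton ℝ c).inverse x = x / c := by
    intro x
    have : x = ContinuousLinearMap.toSpanSingleton ℝ c (x / c) := by
      simp; field_simp
    conv_lhs => rw [this]
    exact h2.inverse_apply_eq.2 rfl
  simp [← hc, hinv]

/-- The profile of the catenoid `C_a`: the radius `a cosh s` as a function of the height. -/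
def profile (a t : ℝ) : ℝ := a * Real.cosh (heightInv a t)

lemma heightInv_zero (ha : 0 < a) : heightInv a 0 = 0 := by
  conv_lhs => rw [← height_zero a]
  exact heightInv_height ha 0

lemma hasDerivAt_profile (ha : 0 < a) (t : ℝ) : HasDerivAt (profile a)
    (2 * Real.sinh (heightInv a t) / coshSpeed a (heightInv a t)) t := by
  have := coshSpeed_pos a (heightInv a t)
  refine (((Real.hasDerivAt_cosh _).comp t (hasDerivAt_heightInv ha t)).const_mul a).congr_deriv ?_
  field_simp

lemma hasDerivAt_coshSpeed (a s : ℝ) : HasDerivAt (coshSpeed a)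
    (a ^ 2 * Real.cosh s * Real.sinh s / coshSpeed a s) s := by
  have h1 := ((((Real.hasDerivAt_cosh s).fun_pow 2).const_mul (a ^ 2)).add_const 4).sqrt
    (by positivity)
  refine h1.congr_deriv ?_
  rw [← coshSpeed]
  have := coshSpeed_pos a s
  field_simp
  simp
  ring

lemma hasDerivAt_deriv_profile (ha : 0 < a) (t : ℝ) : HasDerivAt (deriv (profile a))
    (4 * (a ^ 2 + 4) * Real.cosh (heightInv a t) / (a * coshSpeed a (heightInv a t) ^ 4)) t := by
  rw [funext fun t => (hasDerivAt_profile ha t).deriv]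
  set s := heightInv a t with hs
  have hR := coshSpeed_pos a s
  have h1 : HasDerivAt (fun s => 2 * Real.sinh s / coshSpeed a s)
      (2 * (a ^ 2 + 4) * Real.cosh s / coshSpeed a s ^ 3) s := by
    refine (((Real.hasDerivAt_sinh s).const_mul 2).div (hasDerivAt_coshSpeed a s)
      hR.ne').congr_deriv ?_
    have h2 := coshSpeed_sq a s
    have h3 := Real.cosh_sq s
    field_simp
    rw [h2]
    linear_combination a ^ 2 * h3
  refine (h1.comp t (hasDerivAt_heightInv ha t)).congr_deriv ?_
  rw [← hs]
  field_simp
  norm_num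

lemma isCatenoidProfile_profile (ha : 0 < a) : IsCatenoidProfile a (profile a) where
  contDiff := by
    have h1 : ContDiff ℝ 1 (deriv (profile a)) := by
      rw [contDiff_one_iff_deriv]
      refine ⟨fun t => (hasDerivAt_deriv_profile ha t).differentiableAt, ?_⟩
      rw [funext fun t => (hasDerivAt_deriv_profile ha t).deriv]
      have hc : Continuous (heightInv a) :=
        continuous_iff_continuousAt.2 fun t => (hasDerivAt_heightInv ha t).continuousAt
      have hR := (continuous_coshSpeed_right a).comp hc
      have hch := Real.continuous_cosh.comp hc
      refine Continuous.div (continuous_const.mul hch) (continuous_const.mul (hR.pow 4)) fun t => ?_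
      have := coshSpeed_pos a (heightInv a t)
      exact (by positivity : a * coshSpeed a (heightInv a t) ^ 4 ≠ 0)
    rw [show (2 : WithTop ℕ∞) = 1 + 1 from one_add_one_eq_two.symm, contDiff_succ_iff_deriv]
    exact ⟨fun t => (hasDerivAt_profile ha t).differentiableAt, by simp, h1⟩
  pos t := mul_pos ha (Real.cosh_pos _)
  ode t := by
    rw [(hasDerivAt_profile ha t).deriv, (hasDerivAt_deriv_profile ha t).deriv]
    set s := heightInv a t with hs
    have hR := coshSpeed_pos a s
    have h2 := coshSpeed_sq a s
    have h3 := Real.cosh_sq s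
    rw [show profile a t = a * Real.cosh s from rfl,
      show (a * Real.cosh s) ^ 2 + 4 = coshSpeed a s ^ 2 by rw [h2]; ring]
    field_simp
    rw [h2]
    linear_combination 4 * h3
  init := by simp [profile, heightInv_zero ha]
  init_deriv := by simp [(hasDerivAt_profile ha 0).deriv, heightInv_zero ha]

/-- The parameter derivative of the height, seen from the height, is the integral `τ`. -/
lemma heightParam_heightInv (ha : 0 < a) (t : ℝ) :
    heightParam a (heightInv a t) = parameterShift a (profile a) t := by
  have hc : Continuous fun σ => (a ^ 2 * Real.cosh σ ^ 2 + 2) / coshSpeed a σ :=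
    continuous_heightParam_integrand.comp (by fun_prop : Continuous fun s : ℝ => (a, s))
  have h1 : ∀ s, HasDerivAt (heightParam a) ((a ^ 2 * Real.cosh s ^ 2 + 2) / coshSpeed a s) s :=
    fun s => intervalIntegral.integral_hasDerivAt_right (hc.intervalIntegrable _ _)
      hc.stronglyMeasurable.stronglyMeasurableAtFilter hc.continuousAt
  have h2 : ∀ t, HasDerivAt
      (fun t => heightParam a (heightInv a t) - parameterShift a (profile a) t) 0 t := by
    intro t
    refine (((h1 _).comp t (hasDerivAt_heightInv ha t)).sub
      ((isCatenoidProfile_profile ha).hasDerivAt_parameterShift t)).congr_deriv ?_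
    have hR := coshSpeed_pos a (heightInv a t)
    have h2 := coshSpeed_sq a (heightInv a t)
    rw [profile, mul_pow, ← h2]
    field_simp
    ring
  have := is_const_of_deriv_eq_zero (fun t => (h2 t).differentiableAt) (fun t => (h2 t).deriv) t 0
  simp only [heightInv_zero ha, heightParam, parameterShift, intervalIntegral.integral_same,
    sub_zero] at this
  exact sub_eq_zero.1 this

lemma hasDerivAt_profile_left (ha : 0 < a) (t : ℝ) : HasDerivAt (fun b => profile b t)
    (profile a t / a * parameterField a (profile a) t) a := by
  refine ((hasDerivAt_id a).mul ((Real.hasDerivAt_cosh _).comp a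
    (hasDerivAt_heightInv_left ha t))).congr_deriv ?_
  rw [parameterField, verticalField, (hasDerivAt_profile ha t).deriv, heightParam_heightInv ha,
    profile]
  have hR := coshSpeed_pos a (heightInv a t)
  have hch := Real.cosh_pos (heightInv a t)
  simp only [id, Function.comp]
  field_simp
  ring

lemma variationJacobi_profile (ha : 0 < a) (q : Fin 2 → ℝ) :
    variationJacobi profile a q = parameterField a (profile a) (q 0) := by
  have h := isCatenoidProfile_profile ha
  have hd : HasDerivAt (fun b => revMap (profile b) q)
      ![profile a (q 0) / a * parameterField a (profile a) (q 0) * Real.cos (q 1),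
        profile a (q 0) / a * parameterField a (profile a) (q 0) * Real.sin (q 1), 0] a := by
    rw [hasDerivAt_pi]
    intro k
    fin_cases k
    · exact (hasDerivAt_profile_left ha (q 0)).mul_const _
    · exact (hasDerivAt_profile_left ha (q 0)).mul_const _
    · exact hasDerivAt_const _ _
  have hp := h.pos (q 0)
  have hs := Real.sin_sq_add_cos_sq (q 1)
  rw [variationJacobi, hd.deriv, h.nilInner_revNormal]
  simp
  field_simp
  linear_combination (2 * parameterField a (profile a) (q 0)) * hs

end

section

open MeasureTheory Set

/-! ### A lower bound for Rayleigh quotients -/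

variable {a : ℝ} {g : ℝ → ℝ}

/-- The parameters `(t, θ)` as a linear map on `ℝ × ℝ`. -/
def paramMap : ℝ × ℝ →L[ℝ] (Fin 2 → ℝ) :=
  ContinuousLinearMap.pi
    ![ContinuousLinearMap.fst ℝ ℝ ℝ, ContinuousLinearMap.snd ℝ ℝ ℝ]

lemma paramMap_apply (x : ℝ × ℝ) : paramMap x = ![x.1, x.2] := by
  funext i; fin_cases i <;> rfl

lemma paramMap_one_zero : paramMap (1, 0) = Pi.single 0 1 := by
  funext i; fin_cases i <;> simp [paramMap_apply]

lemma paramMap_zero_one : paramMap (0, 1) = Pi.single 1 1 := by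
  funext i; fin_cases i <;> simp [paramMap_apply]

lemma eq_vec_two (q : Fin 2 → ℝ) : q = ![q 0, q 1] := by
  funext i; fin_cases i <;> rfl

lemma surfaceIntegral_eq_setIntegral {F : (Fin 2 → ℝ) → ℝ} {α β : ℝ}
    (hF : Continuous fun q => F q * areaDensity (revMap g) q)
    (hsupp : ∀ q, q 0 ≤ α ∨ β ≤ q 0 → F q = 0) :
    surfaceIntegral g F = ∫ x in Icc (α, (0 : ℝ)) (β, 2 * Real.pi),
      F (paramMap x) * areaDensity (revMap g) (paramMap x) := by
  have hc : Continuous fun x : ℝ × ℝ =>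
      F (paramMap x) * areaDensity (revMap g) (paramMap x) := hF.comp paramMap.continuous
  rw [surfaceIntegral, ← setIntegral_eq_integral_of_forall_compl_eq_zero (s := Icc α β),
    ← Icc_prod_Icc, Measure.volume_eq_prod, setIntegral_prod]
  · refine setIntegral_congr_fun measurableSet_Icc fun t _ => ?_
    simp only [paramMap_apply]
    rw [intervalIntegral.integral_of_le Real.two_pi_pos.le, integral_Icc_eq_integral_Ioc]
  · exact hc.continuousOn.integrableOn_compact (isCompact_Icc.prod isCompact_Icc)
  · intro t ht
    have : ∀ θ, F ![t, θ] = 0 := fun θ => hsupp _ <| by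
      simp only [mem_Icc, not_and_or, not_le] at ht
      exact ht.imp le_of_lt le_of_lt
    simp [this]

lemma IsCatenoidProfile.continuous_areaDensity (h : IsCatenoidProfile a g) :
    Continuous (areaDensity (revMap g)) := by
  rw [funext h.areaDensity_eq]
  have := h.contDiff.continuous
  fun_prop

lemma IsCatenoidProfile.contDiff_fluxT (h : IsCatenoidProfile a g) {U : (Fin 2 → ℝ) → ℝ}
    (hU : ContDiff ℝ ∞ U) : ContDiff ℝ ∞ (fluxT a g U) :=
  ((h.contDiff_fluxCoeff.comp (contDiff_apply ℝ ℝ 0)).mul (contDiff_pd (m := ∞) hU 0)).add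
    (contDiff_const.mul (contDiff_pd (m := ∞) hU 1))

lemma IsCatenoidProfile.contDiff_fluxTheta (h : IsCatenoidProfile a g) {U : (Fin 2 → ℝ) → ℝ}
    (hU : ContDiff ℝ ∞ U) : ContDiff ℝ ∞ (fluxTheta a g U) :=
  (contDiff_const.mul (contDiff_pd (m := ∞) hU 0)).add
    ((h.contDiff_angularCoeff.comp (contDiff_apply ℝ ℝ 0)).mul (contDiff_pd (m := ∞) hU 1))

lemma IsCatenoidProfile.continuous_jacobiOp_mul (h : IsCatenoidProfile a g)
    {U : (Fin 2 → ℝ) → ℝ} (hU : ContDiff ℝ ∞ U) :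
    Continuous fun q => jacobiOp (revMap g) (revNormal g) U q * areaDensity (revMap g) q := by
  simp only [h.jacobiOp_mul_areaDensity]
  exact (((contDiff_pd (m := ∞) (h.contDiff_fluxT hU) 0).continuous.add
    (contDiff_pd (m := ∞) (h.contDiff_fluxTheta hU) 1).continuous).neg).sub
    ((h.contDiff_potentialDensity.continuous.comp (continuous_apply 0)).mul hU.continuous)

lemma pd_add_period {U : (Fin 2 → ℝ) → ℝ} {v : Fin 2 → ℝ} (hper : ∀ q, U (q + v) = U q)
    (i : Fin 2) (q : Fin 2 → ℝ) : pd i U (q + v) = pd i U q := by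
  rw [pd, ← fderiv_comp_add_right, funext hper, pd]

/-- The quadratic form of the coefficients of `D · Δ` has determinant `1`, hence is positive. -/
lemma principalForm_nonneg (ha : 0 < a) (t ξ η : ℝ) :
    0 ≤ fluxCoeff a g t * ξ ^ 2 + a * ξ * η + angularCoeff a g t * η ^ 2 := by
  have hp := fluxCoeff_pos (g := g) ha t
  have hdet : fluxCoeff a g t * angularCoeff a g t = (a ^ 2 + 4) / 4 := by
    rw [fluxCoeff, angularCoeff]; field_simp
  have : fluxCoeff a g t *
      (fluxCoeff a g t * ξ ^ 2 + a * ξ * η + angularCoeff a g t * η ^ 2) =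
      (fluxCoeff a g t * ξ + a / 2 * η) ^ 2 + η ^ 2 := by
    linear_combination η ^ 2 * hdet
  exact nonneg_of_mul_nonneg_right (this ▸ by positivity) hp

/-- If `r` satisfies the Riccati inequality `r' + r² / p + κ + c D ≤ 0`, then completing the square
in `u J u` leaves `c u²` and a divergence, so `∫ u J u ≥ c ∫ u²`. -/
lemma IsCatenoidProfile.mul_surfaceIntegral_le (h : IsCatenoidProfile a g)
    {U : (Fin 2 → ℝ) → ℝ} (hU : ContDiff ℝ ∞ U)
    (hper : ∀ q, U (q + Pi.single 1 (2 * Real.pi)) = U q) {α β : ℝ} (hαβ : α < β)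
    (hsupp : ∀ q, q 0 ≤ α ∨ β ≤ q 0 → U q = 0) {r r' : ℝ → ℝ}
    (hr : ∀ t ∈ Icc α β, HasDerivAt r (r' t) t) (hr' : ContinuousOn r' (Icc α β)) {c : ℝ}
    (hric : ∀ t ∈ Icc α β,
      r' t + r t ^ 2 / fluxCoeff a g t + potentialDensity a g t + c * (g t ^ 2 / a) ≤ 0) :
    c * surfaceIntegral g (fun q => U q ^ 2) ≤
      surfaceIntegral g fun q => U q * jacobiOp (revMap g) (revNormal g) U q := by
  have ha := h.init_pos
  have hD := h.continuous_areaDensity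
  set box : Set (ℝ × ℝ) := Icc (α, (0 : ℝ)) (β, 2 * Real.pi) with hbox
  have hcont1 : Continuous fun q => U q ^ 2 * areaDensity (revMap g) q :=
    (hU.continuous.pow 2).mul hD
  have hcont2 : Continuous fun q =>
      U q * jacobiOp (revMap g) (revNormal g) U q * areaDensity (revMap g) q := by
    simp only [mul_assoc]
    exact hU.continuous.mul (h.continuous_jacobiOp_mul hU)
  rw [surfaceIntegral_eq_setIntegral hcont1 (fun q hq => by simp [hsupp q hq]),
    surfaceIntegral_eq_setIntegral hcont2 (fun q hq => by simp [hsupp q hq]),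
    ← integral_const_mul]
  have hboxc : IsCompact box := isCompact_Icc
  have hmem : ∀ x ∈ box, paramMap x 0 ∈ Icc α β := fun x hx => ⟨hx.1.1, hx.2.1⟩
  -- the divergence, in closed form
  set T := fluxT a g U with hT
  set Θ := fluxTheta a g U with hΘ
  have hTs : ContDiff ℝ ∞ T := h.contDiff_fluxT hU
  have hΘs : ContDiff ℝ ∞ Θ := h.contDiff_fluxTheta hU
  have hUd : Differentiable ℝ U := hU.differentiable (by simp)
  have hTd : Differentiable ℝ T := hTs.differentiable (by simp)
  have hΘd : Differentiable ℝ Θ := hΘs.differentiable (by simp)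
  have hpd : Differentiable ℝ (fluxCoeff a g) := h.contDiff_fluxCoeff.differentiable (by simp)
  set A : (Fin 2 → ℝ) → ℝ := fun q => r (q 0) * (U q * U q) - U q * T q with hA
  set B : (Fin 2 → ℝ) → ℝ := fun q =>
    (a / 2 * (r (q 0) / fluxCoeff a g (q 0))) * (U q * U q) - U q * Θ q with hB
  have hrd : ∀ q : Fin 2 → ℝ, q 0 ∈ Icc α β → DifferentiableAt ℝ (fun q => r (q 0)) q :=
    fun q hq => (hr _ hq).differentiableAt.comp q (differentiableAt_apply 0 q)
  have hsd : ∀ t ∈ Icc α β, DifferentiableAt ℝ (fun t => a / 2 * (r t / fluxCoeff a g t)) t :=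
    fun t ht => ((hr _ ht).differentiableAt.div (hpd t) (fluxCoeff_pos ha t).ne').const_mul _
  have hsd' : ∀ q : Fin 2 → ℝ, q 0 ∈ Icc α β →
      DifferentiableAt ℝ (fun q => a / 2 * (r (q 0) / fluxCoeff a g (q 0))) q :=
    fun q hq => DifferentiableAt.comp (g := fun t => a / 2 * (r t / fluxCoeff a g t))
      (f := fun q : Fin 2 → ℝ => q 0) q (hsd _ hq) (differentiableAt_apply 0 q)
  have hAd : ∀ q : Fin 2 → ℝ, q 0 ∈ Icc α β → DifferentiableAt ℝ A q := fun q hq =>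
    ((hrd q hq).mul ((hUd q).mul (hUd q))).sub ((hUd q).mul (hTd q))
  have hBd : ∀ q : Fin 2 → ℝ, q 0 ∈ Icc α β → DifferentiableAt ℝ B q := fun q hq =>
    ((hsd' q hq).mul ((hUd q).mul (hUd q))).sub ((hUd q).mul (hΘd q))
  have hpdA : ∀ q : Fin 2 → ℝ, q 0 ∈ Icc α β → pd 0 A q =
      r' (q 0) * (U q * U q) + r (q 0) * (pd 0 U q * U q + U q * pd 0 U q)
        - (pd 0 U q * T q + U q * pd 0 T q) := by
    intro q hq
    have hUU : DifferentiableAt ℝ (fun q => U q * U q) q := (hUd q).mul (hUd q)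
    have hrUU : DifferentiableAt ℝ (fun q => r (q 0) * (U q * U q)) q := (hrd q hq).mul hUU
    have hUT : DifferentiableAt ℝ (fun q => U q * T q) q := (hUd q).mul (hTd q)
    rw [hA, pd_sub 0 hrUU hUT, pd_mul 0 (hrd q hq) hUU,
      pd_mul 0 (hUd q) (hUd q), pd_mul 0 (hUd q) (hTd q), pd_comp_coord 0 0 (hr _ hq)]
    simp
  have hpdB : ∀ q : Fin 2 → ℝ, q 0 ∈ Icc α β → pd 1 B q =
      (a / 2 * (r (q 0) / fluxCoeff a g (q 0))) * (pd 1 U q * U q + U q * pd 1 U q)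
        - (pd 1 U q * Θ q + U q * pd 1 Θ q) := by
    intro q hq
    have hUU : DifferentiableAt ℝ (fun q => U q * U q) q := (hUd q).mul (hUd q)
    have hrUU : DifferentiableAt ℝ
        (fun q => a / 2 * (r (q 0) / fluxCoeff a g (q 0)) * (U q * U q)) q := (hsd' q hq).mul hUU
    have hUΘ : DifferentiableAt ℝ (fun q => U q * Θ q) q := (hUd q).mul (hΘd q)
    rw [hB, pd_sub 1 hrUU hUΘ, pd_mul 1 (hsd' q hq) hUU,
      pd_mul 1 (hUd q) (hUd q), pd_mul 1 (hUd q) (hΘd q),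
      pd_one_comp_coord_zero (fun t => a / 2 * (r t / fluxCoeff a g t))]
    simp
  have hcontU : Continuous fun x => U (paramMap x) := hU.continuous.comp paramMap.continuous
  have hcontP : ∀ i, Continuous fun x => pd i U (paramMap x) := fun i =>
    (contDiff_pd (m := ∞) hU i).continuous.comp paramMap.continuous
  have hrc : ContinuousOn (fun x => r (paramMap x 0)) box := fun x hx =>
    ((hr _ (hmem x hx)).continuousAt.comp (f := fun x => paramMap x 0)
      (by fun_prop)).continuousWithinAt
  have hrc' : ContinuousOn (fun x => r' (paramMap x 0)) box :=
    hr'.comp (f := fun x => paramMap x 0) (by fun_prop) hmem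
  have hpc : Continuous fun x => fluxCoeff a g (paramMap x 0) :=
    h.contDiff_fluxCoeff.continuous.comp (by fun_prop)
  have hdivc : ContinuousOn (fun x => pd 0 A (paramMap x) + pd 1 B (paramMap x)) box := by
    have hcT : Continuous fun x => T (paramMap x) := hTs.continuous.comp paramMap.continuous
    have hcΘ : Continuous fun x => Θ (paramMap x) := hΘs.continuous.comp paramMap.continuous
    have hcT' : Continuous fun x => pd 0 T (paramMap x) :=
      (contDiff_pd (m := ∞) hTs 0).continuous.comp paramMap.continuous
    have hcΘ' : Continuous fun x => pd 1 Θ (paramMap x) :=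
      (contDiff_pd (m := ∞) hΘs 1).continuous.comp paramMap.continuous
    have h0 := hcontP 0
    have h1 := hcontP 1
    refine ContinuousOn.congr (f := fun x =>
      (r' (paramMap x 0) * (U (paramMap x) * U (paramMap x))
        + r (paramMap x 0) * (pd 0 U (paramMap x) * U (paramMap x)
          + U (paramMap x) * pd 0 U (paramMap x))
        - (pd 0 U (paramMap x) * T (paramMap x) + U (paramMap x) * pd 0 T (paramMap x)))
      + ((a / 2 * (r (paramMap x 0) / fluxCoeff a g (paramMap x 0))) *
          (pd 1 U (paramMap x) * U (paramMap x) + U (paramMap x) * pd 1 U (paramMap x))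
        - (pd 1 U (paramMap x) * Θ (paramMap x) + U (paramMap x) * pd 1 Θ (paramMap x)))) ?_ ?_
    · have hq : ContinuousOn (fun x => r (paramMap x 0) / fluxCoeff a g (paramMap x 0)) box :=
        hrc.div hpc.continuousOn fun x _ => (fluxCoeff_pos ha _).ne'
      exact (((hrc'.mul (hcontU.mul hcontU).continuousOn).add
          (hrc.mul ((h0.mul hcontU).add (hcontU.mul h0)).continuousOn)).sub
          ((h0.mul hcT).add (hcontU.mul hcT')).continuousOn).add
        (((continuousOn_const.mul hq).mul ((h1.mul hcontU).add (hcontU.mul h1)).continuousOn).sub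
          ((h1.mul hcΘ).add (hcontU.mul hcΘ')).continuousOn)
    · intro x hx
      simp only [hpdA _ (hmem x hx), hpdB _ (hmem x hx)]
  -- the divergence integrates to zero
  have hzero : ∫ x in box, (pd 0 A (paramMap x) + pd 1 B (paramMap x)) = 0 := by
    have hdiv := integral_divergence_prod_Icc_of_hasFDerivAt_off_countable_of_le
      (fun x => A (paramMap x)) (fun x => B (paramMap x))
      (fun x => (fderiv ℝ A (paramMap x)).comp paramMap)
      (fun x => (fderiv ℝ B (paramMap x)).comp paramMap) (α, (0 : ℝ)) (β, 2 * Real.pi)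
      ⟨hαβ.le, Real.two_pi_pos.le⟩ ∅ countable_empty
      (fun x hx => ((hAd _ (hmem x hx)).continuousAt.comp
        paramMap.continuous.continuousAt).continuousWithinAt)
      (fun x hx => ((hBd _ (hmem x hx)).continuousAt.comp
        paramMap.continuous.continuousAt).continuousWithinAt)
      (fun x hx => (hAd _ ⟨hx.1.1.1.le, hx.1.1.2.le⟩).hasFDerivAt.comp x paramMap.hasFDerivAt)
      (fun x hx => (hBd _ ⟨hx.1.1.1.le, hx.1.1.2.le⟩).hasFDerivAt.comp x paramMap.hasFDerivAt)
      (by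
        simp only [ContinuousLinearMap.comp_apply, paramMap_one_zero, paramMap_zero_one]
        exact hdivc.integrableOn_compact hboxc)
    simp only [ContinuousLinearMap.comp_apply, paramMap_one_zero, paramMap_zero_one] at hdiv
    refine hdiv.trans ?_
    have hβ : ∀ θ, A (paramMap (β, θ)) = 0 := fun θ => by
      simp [hA, hsupp (paramMap (β, θ)) (Or.inr (by simp [paramMap_apply]))]
    have hα : ∀ θ, A (paramMap (α, θ)) = 0 := fun θ => by
      simp [hA, hsupp (paramMap (α, θ)) (Or.inl (by simp [paramMap_apply]))]
    have hBper : ∀ t, B (paramMap (t, 2 * Real.pi)) = B (paramMap (t, 0)) := fun t => by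
      have e : paramMap (t, 2 * Real.pi) = paramMap (t, 0) + Pi.single 1 (2 * Real.pi) := by
        funext i; fin_cases i <;> simp [paramMap_apply]
      have e0 : (paramMap (t, 0) + (Pi.single 1 (2 * Real.pi) : Fin 2 → ℝ)) 0 = paramMap (t, 0) 0 := by simp
      simp only [hB, hΘ, fluxTheta]
      rw [e, hper, pd_add_period hper, pd_add_period hper, e0]
    simp [hα, hβ, hBper]
  rw [← sub_nonneg, ← integral_sub]
  · refine le_trans hzero.ge ?_
    refine setIntegral_mono_on (hdivc.integrableOn_compact hboxc) ?_ measurableSet_Icc ?_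
    · exact (((hcont2.comp paramMap.continuous).sub
        (continuous_const.mul (hcont1.comp paramMap.continuous))).continuousOn).integrableOn_compact
        hboxc
    · intro x hx
      set q := paramMap x with hq
      have hqm := hmem x hx
      have hp := fluxCoeff_pos (g := g) ha (q 0)
      have e : U q * jacobiOp (revMap g) (revNormal g) U q * areaDensity (revMap g) q =
          U q * (-(pd 0 T q + pd 1 Θ q) - potentialDensity a g (q 0) * U q) := by
        rw [mul_assoc, h.jacobiOp_mul_areaDensity]
      rw [hpdA q hqm, hpdB q hqm, e, h.areaDensity_eq]
      have h1 := principalForm_nonneg (g := g) ha (q 0)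
        (pd 0 U q - r (q 0) / fluxCoeff a g (q 0) * U q) (pd 1 U q)
      have h2 := mul_nonneg (neg_nonneg.2 (hric _ hqm)) (sq_nonneg (U q))
      have hTq : T q = fluxCoeff a g (q 0) * pd 0 U q + a / 2 * pd 1 U q := rfl
      have hΘq : Θ q = a / 2 * pd 0 U q + angularCoeff a g (q 0) * pd 1 U q := rfl
      have h3 : r (q 0) ^ 2 / fluxCoeff a g (q 0) =
          fluxCoeff a g (q 0) * (r (q 0) / fluxCoeff a g (q 0)) ^ 2 := by field_simp
      have h4 : r (q 0) = fluxCoeff a g (q 0) * (r (q 0) / fluxCoeff a g (q 0)) := by field_simp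
      rw [h3] at h2
      rw [hTq, hΘq]
      set R := r (q 0) / fluxCoeff a g (q 0)
      rw [h4]
      nlinarith [h1, h2]
  · exact (hcont2.comp paramMap.continuous).continuousOn.integrableOn_compact hboxc
  · exact (continuous_const.mul (hcont1.comp
      paramMap.continuous)).continuousOn.integrableOn_compact hboxc

lemma IsCatenoidProfile.surfaceIntegral_sq_pos (h : IsCatenoidProfile a g)
    {U : (Fin 2 → ℝ) → ℝ} (hU : Continuous U)
    (hper : ∀ q, U (q + Pi.single 1 (2 * Real.pi)) = U q) {α β : ℝ} (hαβ : α < β)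
    (hsupp : ∀ q, q 0 ≤ α ∨ β ≤ q 0 → U q = 0) {q : Fin 2 → ℝ} (hq : U q ≠ 0) :
    0 < surfaceIntegral g fun q => U q ^ 2 := by
  have ha := h.init_pos
  set box : Set (ℝ × ℝ) := Icc (α, (0 : ℝ)) (β, 2 * Real.pi) with hbox
  have hcont : Continuous fun q => U q ^ 2 * areaDensity (revMap g) q :=
    (hU.pow 2).mul h.continuous_areaDensity
  have hDpos : ∀ q, 0 < areaDensity (revMap g) q := fun q => by
    have := h.pos (q 0)
    rw [h.areaDensity_eq]; positivity
  rw [surfaceIntegral_eq_setIntegral hcont (fun q hq => by simp [hsupp q hq])]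
  have hnn : ∀ x : ℝ × ℝ, 0 ≤ U (paramMap x) ^ 2 * areaDensity (revMap g) (paramMap x) :=
    fun x => mul_nonneg (sq_nonneg _) (hDpos _).le
  have hc : Continuous fun x : ℝ × ℝ => U (paramMap x) ^ 2 * areaDensity (revMap g) (paramMap x) :=
    hcont.comp paramMap.continuous
  refine (integral_nonneg hnn).lt_of_ne fun h0 => hq ?_
  have hae := (setIntegral_eq_zero_iff_of_nonneg_ae (Filter.Eventually.of_forall hnn)
    (hc.continuousOn.integrableOn_compact isCompact_Icc)).1 h0.symm
  have hEq : EqOn (fun x : ℝ × ℝ => U (paramMap x) ^ 2 * areaDensity (revMap g) (paramMap x))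
      (fun _ => 0) box := by
    refine Measure.eqOn_of_ae_eq hae hc.continuousOn continuousOn_const ?_
    rw [hbox, ← Icc_prod_Icc, interior_prod_eq, closure_prod_eq, interior_Icc, interior_Icc,
      closure_Ioo hαβ.ne, closure_Ioo Real.two_pi_pos.ne]
  -- the parameter `θ` can be taken in `[0, 2π]`
  have hperiodic : Function.Periodic (fun θ => U ![q 0, θ]) (2 * Real.pi) := fun θ => by
    change U _ = U _
    rw [← hper ![q 0, θ]]
    congr 1
    funext i; fin_cases i <;> simp
  obtain ⟨θ, hθ, hUθ⟩ := hperiodic.exists_mem_Ico₀ Real.two_pi_pos (q 1)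
  rw [eq_vec_two q, hUθ]
  by_cases hq0 : q 0 ≤ α ∨ β ≤ q 0
  · exact hsupp _ hq0
  · push Not at hq0
    have := hEq (x := (q 0, θ)) ⟨⟨hq0.1.le, hθ.1⟩, ⟨hq0.2.le, hθ.2.le⟩⟩
    simpa [paramMap_apply, (hDpos _).ne'] using this

end

section

open MeasureTheory Set

variable {a : ℝ} {g w P : ℝ → ℝ}

/-- A positive Jacobi field `w` gives the solution `p w' / w` of the Riccati equation; subtracting
`δ t / w²` turns it into a strict subsolution. -/
lemma IsJacobiPair.mul_surfaceIntegral_le (hw : IsJacobiPair a g w P) (h : IsCatenoidProfile a g)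
    {U : (Fin 2 → ℝ) → ℝ} (hU : ContDiff ℝ ∞ U)
    (hper : ∀ q, U (q + Pi.single 1 (2 * Real.pi)) = U q) {α β : ℝ} (hαβ : α < β)
    (hsupp : ∀ q, q 0 ≤ α ∨ β ≤ q 0 → U q = 0) (hpos : ∀ t ∈ Icc α β, 0 < w t) {δ c : ℝ}
    (hδ : ∀ t ∈ Icc α β,
      δ ^ 2 * t ^ 2 / (fluxCoeff a g t * w t ^ 4) + c * (g t ^ 2 / a) ≤ δ / w t ^ 2) :
    c * surfaceIntegral g (fun q => U q ^ 2) ≤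
      surfaceIntegral g fun q => U q * jacobiOp (revMap g) (revNormal g) U q := by
  have ha := h.init_pos
  refine h.mul_surfaceIntegral_le hU hper hαβ hsupp (r := fun t => P t / w t - δ * t / w t ^ 2)
    (r' := fun t => -potentialDensity a g t - P t ^ 2 / (fluxCoeff a g t * w t ^ 2)
      - δ / w t ^ 2 + 2 * δ * t * P t / (fluxCoeff a g t * w t ^ 3)) ?_ ?_ ?_
  · intro t ht
    have hwt := hpos t ht
    have hp := fluxCoeff_pos (g := g) ha t
    refine (((hw.hasDerivAt_flux t).div (hw.hasDerivAt t) hwt.ne').sub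
      (((hasDerivAt_id t).const_mul δ).div ((hw.hasDerivAt t).fun_pow 2)
        (by positivity))).congr_deriv ?_
    simp only [id]
    field_simp
    push_cast
    ring
  · have hwc : Continuous w := (hw.contDiff_infty h).continuous
    have hPc : Continuous P :=
      continuous_iff_continuousAt.2 fun t => (hw.hasDerivAt_flux t).continuousAt
    have hpc := h.contDiff_fluxCoeff.continuous
    have hκ := h.contDiff_potentialDensity.continuous
    have hw0 : ∀ t ∈ Icc α β, w t ≠ 0 := fun t ht => (hpos t ht).ne'
    have hp0 : ∀ t, fluxCoeff a g t ≠ 0 := fun t => (fluxCoeff_pos ha t).ne'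
    refine ((hκ.neg.continuousOn.sub ((hPc.pow 2).continuousOn.div
      (hpc.mul (hwc.pow 2)).continuousOn fun t ht =>
        mul_ne_zero (hp0 t) (pow_ne_zero _ (hw0 t ht)))).sub
      (continuousOn_const.div (hwc.pow 2).continuousOn fun t ht =>
        pow_ne_zero _ (hw0 t ht))).add (ContinuousOn.div ?_
      (hpc.mul (hwc.pow 3)).continuousOn fun t ht =>
        mul_ne_zero (hp0 t) (pow_ne_zero _ (hw0 t ht)))
    fun_prop
  · intro t ht
    have hwt := hpos t ht
    have hp := fluxCoeff_pos (g := g) ha t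
    have e : (P t / w t - δ * t / w t ^ 2) ^ 2 / fluxCoeff a g t =
        P t ^ 2 / (fluxCoeff a g t * w t ^ 2) - 2 * δ * t * P t / (fluxCoeff a g t * w t ^ 3)
          + δ ^ 2 * t ^ 2 / (fluxCoeff a g t * w t ^ 4) := by
      field_simp; ring
    have := hδ t ht
    simp only [e]
    linarith

/-- On a compact interval where `w > 0`, the strict subsolution exists with some `c > 0`. -/
lemma IsJacobiPair.exists_riccati (hw : IsJacobiPair a g w P) (h : IsCatenoidProfile a g)
    {α β : ℝ} (hpos : ∀ t ∈ Icc α β, 0 < w t) :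
    ∃ δ c : ℝ, 0 < c ∧ ∀ t ∈ Icc α β,
      δ ^ 2 * t ^ 2 / (fluxCoeff a g t * w t ^ 4) + c * (g t ^ 2 / a) ≤ δ / w t ^ 2 := by
  have ha := h.init_pos
  have hwc : Continuous w := (hw.contDiff_infty h).continuous
  have hpc := h.contDiff_fluxCoeff.continuous
  have hgc := h.contDiff.continuous
  obtain ⟨M, hM⟩ := isCompact_Icc.exists_bound_of_continuousOn
    (f := fun t => t ^ 2 / (fluxCoeff a g t * w t ^ 2)) (s := Icc α β)
    ((continuous_pow 2).continuousOn.div (hpc.mul (hwc.pow 2)).continuousOn fun t ht =>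
      mul_ne_zero (fluxCoeff_pos ha t).ne' (pow_ne_zero _ (hpos t ht).ne'))
  obtain ⟨N, hN⟩ := isCompact_Icc.exists_bound_of_continuousOn
    (f := fun t => g t ^ 2 / a * w t ^ 2) (s := Icc α β) (by fun_prop)
  refine ⟨(2 * (|M| + 1))⁻¹, (2 * (|M| + 1))⁻¹ / (2 * (|N| + 1)), by positivity, fun t ht => ?_⟩
  set δ := (2 * (|M| + 1))⁻¹ with hδ
  have hδ0 : 0 < δ := by positivity
  have hwt := hpos t ht
  have hp := fluxCoeff_pos (g := g) ha t
  have h1 : t ^ 2 / (fluxCoeff a g t * w t ^ 2) ≤ |M| + 1 := by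
    have := (le_abs_self _).trans ((hM t ht).trans (le_abs_self M)); linarith
  have h2 : g t ^ 2 / a * w t ^ 2 ≤ |N| + 1 := by
    have := (le_abs_self _).trans ((hN t ht).trans (le_abs_self N)); linarith
  have e1 : δ ^ 2 * t ^ 2 / (fluxCoeff a g t * w t ^ 4) ≤ δ / w t ^ 2 / 2 := by
    have e : δ ^ 2 * t ^ 2 / (fluxCoeff a g t * w t ^ 4) =
        δ / w t ^ 2 * (δ * (t ^ 2 / (fluxCoeff a g t * w t ^ 2))) := by field_simp
    have : δ * (t ^ 2 / (fluxCoeff a g t * w t ^ 2)) ≤ 1 / 2 := by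
      calc _ ≤ δ * (|M| + 1) := by gcongr
        _ = 1 / 2 := by rw [hδ]; field_simp
    rw [e]
    calc _ ≤ δ / w t ^ 2 * (1 / 2) := by gcongr
      _ = _ := by ring
  have e2 : δ / (2 * (|N| + 1)) * (g t ^ 2 / a) ≤ δ / w t ^ 2 / 2 := by
    have e : δ / (2 * (|N| + 1)) * (g t ^ 2 / a) =
        δ / w t ^ 2 / 2 * ((g t ^ 2 / a * w t ^ 2) / (|N| + 1)) := by field_simp
    rw [e]
    have : (g t ^ 2 / a * w t ^ 2) / (|N| + 1) ≤ 1 := (div_le_one (by positivity)).2 h2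
    calc _ ≤ δ / w t ^ 2 / 2 * 1 := by gcongr
      _ = _ := by ring
  linarith

/-! ### Cutoffs of a Jacobi field vanishing at both ends -/

/-- A smooth function equal to `0` on `(-∞, 1]` and to `1` on `[2, ∞)`. -/
def cutoff (x : ℝ) : ℝ := Real.smoothTransition (x - 1)

lemma contDiff_cutoff : ContDiff ℝ ∞ cutoff :=
  Real.smoothTransition.contDiff.comp (contDiff_id.sub contDiff_const)

lemma cutoff_of_le {x : ℝ} (hx : x ≤ 1) : cutoff x = 0 :=
  Real.smoothTransition.zero_of_nonpos (by linarith)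

lemma cutoff_of_ge {x : ℝ} (hx : 2 ≤ x) : cutoff x = 1 :=
  Real.smoothTransition.one_of_one_le (by linarith)

lemma cutoff_nonneg (x : ℝ) : 0 ≤ cutoff x := Real.smoothTransition.nonneg _

lemma cutoff_le_one (x : ℝ) : cutoff x ≤ 1 := Real.smoothTransition.le_one _

lemma hasDerivAt_cutoff (x : ℝ) : HasDerivAt cutoff (deriv cutoff x) x :=
  (contDiff_cutoff.differentiable (by simp) x).hasDerivAt

lemma continuous_deriv_cutoff : Continuous (deriv cutoff) :=
  contDiff_cutoff.continuous_deriv (by simp)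

lemma deriv_cutoff_of_gt {x : ℝ} (hx : 2 < x) : deriv cutoff x = 0 := by
  have : cutoff =ᶠ[𝓝 x] fun _ => 1 := by
    filter_upwards [lt_mem_nhds hx] with y hy using cutoff_of_ge hy.le
  rw [this.deriv_eq, deriv_const]

lemma deriv_cutoff_of_lt {x : ℝ} (hx : x < 1) : deriv cutoff x = 0 := by
  have : cutoff =ᶠ[𝓝 x] fun _ => 0 := by
    filter_upwards [gt_mem_nhds hx] with y hy using cutoff_of_le hy.le
  rw [this.deriv_eq, deriv_const]

lemma exists_mul_deriv_cutoff_le : ∃ B : ℝ, 0 ≤ B ∧ ∀ x : ℝ, |x * deriv cutoff x| ≤ B := by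
  obtain ⟨B, hB⟩ := (isCompact_Icc (a := (1 : ℝ)) (b := 2)).exists_bound_of_continuousOn
    (f := fun x => x * deriv cutoff x) (continuous_id.mul continuous_deriv_cutoff).continuousOn
  refine ⟨|B|, abs_nonneg _, fun x => ?_⟩
  by_cases h1 : x < 1
  · simp [deriv_cutoff_of_lt h1]
  by_cases h2 : 2 < x
  · simp [deriv_cutoff_of_gt h2]
  · exact (hB x ⟨not_lt.1 h1, not_lt.1 h2⟩).trans (le_abs_self B)

/-- The cutoff at distance about `1 / n` of the ends of `[s, t]`. -/
def intervalCutoff (s t : ℝ) (n : ℕ) (x : ℝ) : ℝ := cutoff (n * (x - s)) * cutoff (n * (t - x))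

/-- The derivative of `intervalCutoff`. -/
def intervalCutoffDeriv (s t : ℝ) (n : ℕ) (x : ℝ) : ℝ :=
  n * deriv cutoff (n * (x - s)) * cutoff (n * (t - x))
    - cutoff (n * (x - s)) * (n * deriv cutoff (n * (t - x)))

lemma contDiff_intervalCutoff (s t : ℝ) (n : ℕ) : ContDiff ℝ ∞ (intervalCutoff s t n) :=
  (contDiff_cutoff.comp (by fun_prop)).mul (contDiff_cutoff.comp (by fun_prop))

lemma hasDerivAt_intervalCutoff (s t : ℝ) (n : ℕ) (x : ℝ) :
    HasDerivAt (intervalCutoff s t n) (intervalCutoffDeriv s t n x) x := by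
  have h1 : HasDerivAt (fun x : ℝ => n * (x - s)) (n : ℝ) x := by
    simpa using ((hasDerivAt_id x).sub_const s).const_mul (n : ℝ)
  have h2 : HasDerivAt (fun x : ℝ => n * (t - x)) (-(n : ℝ)) x := by
    simpa using ((hasDerivAt_id x).const_sub t).const_mul (n : ℝ)
  refine (((hasDerivAt_cutoff _).comp x h1).mul ((hasDerivAt_cutoff _).comp x h2)).congr_deriv ?_
  simp only [Function.comp, intervalCutoffDeriv]
  ring

lemma continuous_intervalCutoffDeriv (s t : ℝ) (n : ℕ) :
    Continuous (intervalCutoffDeriv s t n) := by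
  have h1 := continuous_deriv_cutoff
  have h2 := contDiff_cutoff.continuous
  unfold intervalCutoffDeriv
  fun_prop

lemma intervalCutoff_eq_zero {s t : ℝ} {n : ℕ} (hn : n ≠ 0) {x : ℝ}
    (hx : x ≤ s + (n : ℝ)⁻¹ ∨ t - (n : ℝ)⁻¹ ≤ x) : intervalCutoff s t n x = 0 := by
  have hn' : (0 : ℝ) < n := by positivity
  have e : (n : ℝ) * (n : ℝ)⁻¹ = 1 := mul_inv_cancel₀ hn'.ne'
  rcases hx with hx | hx
  · rw [intervalCutoff, cutoff_of_le (by nlinarith), zero_mul]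
  · rw [intervalCutoff, cutoff_of_le (x := n * (t - x)) (by nlinarith), mul_zero]

lemma eventually_intervalCutoff {s t x : ℝ} (hx : x ∈ Ioo s t) :
    ∀ᶠ n : ℕ in Filter.atTop, intervalCutoff s t n x = 1 ∧ intervalCutoffDeriv s t n x = 0 := by
  have h1 : Filter.Tendsto (fun n : ℕ => (n : ℝ) * (x - s)) Filter.atTop Filter.atTop :=
    tendsto_natCast_atTop_atTop.atTop_mul_const (sub_pos.2 hx.1)
  have h2 : Filter.Tendsto (fun n : ℕ => (n : ℝ) * (t - x)) Filter.atTop Filter.atTop :=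
    tendsto_natCast_atTop_atTop.atTop_mul_const (sub_pos.2 hx.2)
  filter_upwards [h1.eventually_gt_atTop 2, h2.eventually_gt_atTop 2] with n hn1 hn2
  simp [intervalCutoff, intervalCutoffDeriv, cutoff_of_ge hn1.le, cutoff_of_ge hn2.le,
    deriv_cutoff_of_gt hn1, deriv_cutoff_of_gt hn2]

lemma IsJacobiPair.exists_abs_le (hw : IsJacobiPair a g w P) (h : IsCatenoidProfile a g)
    {s t : ℝ} (hs : w s = 0) (ht : w t = 0) :
    ∃ L : ℝ, 0 ≤ L ∧ ∀ x ∈ Icc s t, |w x| ≤ L * (x - s) ∧ |w x| ≤ L * (t - x) := by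
  have hc : Continuous fun x => P x / fluxCoeff a g x :=
    (continuous_iff_continuousAt.2 fun t => (hw.hasDerivAt_flux t).continuousAt).div
      h.contDiff_fluxCoeff.continuous fun x => (fluxCoeff_pos h.init_pos x).ne'
  obtain ⟨L, hL⟩ := isCompact_Icc.exists_bound_of_continuousOn (s := Icc s t) hc.continuousOn
  refine ⟨|L|, abs_nonneg _, fun x hx => ?_⟩
  have hst : s ≤ t := hx.1.trans hx.2
  have hL' : ∀ x ∈ Icc s t, ‖P x / fluxCoeff a g x‖ ≤ |L| :=
    fun x hx => (hL x hx).trans (le_abs_self L)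
  have hd : ∀ x ∈ Icc s t, HasDerivWithinAt w (P x / fluxCoeff a g x) (Icc s t) x :=
    fun x _ => (hw.hasDerivAt x).hasDerivWithinAt
  have h1 := (convex_Icc s t).norm_image_sub_le_of_norm_hasDerivWithin_le hd hL'
    (left_mem_Icc.2 hst) hx
  have h2 := (convex_Icc s t).norm_image_sub_le_of_norm_hasDerivWithin_le hd hL'
    (right_mem_Icc.2 hst) hx
  rw [hs, sub_zero, Real.norm_eq_abs, Real.norm_eq_abs, abs_of_nonneg (sub_nonneg.2 hx.1)] at h1
  rw [ht, sub_zero, Real.norm_eq_abs, Real.norm_eq_abs, abs_of_nonpos (sub_nonpos.2 hx.2),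
    neg_sub] at h2
  exact ⟨h1, h2⟩

/-- The energy `∫ p w² χ'²` of the cutoffs tends to zero, because `w` vanishes linearly where
`χ'` is of order `n` on a set of length of order `1 / n`. -/
lemma IsJacobiPair.tendsto_energy (hw : IsJacobiPair a g w P) (h : IsCatenoidProfile a g)
    {s t : ℝ} (hst : s < t) (hs : w s = 0) (ht : w t = 0) :
    Filter.Tendsto (fun n : ℕ => ∫ x in s..t,
      fluxCoeff a g x * w x ^ 2 * intervalCutoffDeriv s t n x ^ 2) Filter.atTop (𝓝 0) := by
  obtain ⟨L, hL0, hL⟩ := hw.exists_abs_le h hs ht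
  obtain ⟨B, hB0, hB⟩ := exists_mul_deriv_cutoff_le
  have hwc : Continuous w := (hw.contDiff_infty h).continuous
  have hpc := h.contDiff_fluxCoeff.continuous
  have := intervalIntegral.tendsto_integral_filter_of_dominated_convergence
    (μ := volume) (a := s) (b := t) (l := Filter.atTop)
    (F := fun (n : ℕ) x => fluxCoeff a g x * w x ^ 2 * intervalCutoffDeriv s t n x ^ 2)
    (f := fun _ => 0) (fun x => fluxCoeff a g x * (2 * L * B) ^ 2) ?_ ?_ ?_ ?_
  · simpa using this
  · exact Filter.Eventually.of_forall fun n =>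
      ((hpc.mul (hwc.pow 2)).mul
        ((continuous_intervalCutoffDeriv s t n).pow 2)).aestronglyMeasurable
  · refine Filter.Eventually.of_forall fun n => Filter.Eventually.of_forall fun x hx => ?_
    rw [uIoc_of_le hst.le] at hx
    obtain ⟨h1, h2⟩ := hL x ⟨hx.1.le, hx.2⟩
    have hp := fluxCoeff_pos (g := g) h.init_pos x
    have hb : |w x * intervalCutoffDeriv s t n x| ≤ 2 * L * B := by
      have e : w x * intervalCutoffDeriv s t n x =
          w x * (n * deriv cutoff (n * (x - s))) * cutoff (n * (t - x))
            - w x * (n * deriv cutoff (n * (t - x))) * cutoff (n * (x - s)) := by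
        rw [intervalCutoffDeriv]; ring
      have bound : ∀ y z : ℝ, 0 ≤ y → |w x| ≤ L * y →
          |w x * (n * deriv cutoff (n * y)) * cutoff z| ≤ L * B := by
        intro y z hy hwy
        rw [abs_mul, abs_mul, abs_of_nonneg (cutoff_nonneg z)]
        calc |w x| * |n * deriv cutoff (n * y)| * cutoff z
            ≤ L * y * |n * deriv cutoff (n * y)| * 1 :=
              mul_le_mul (by gcongr) (cutoff_le_one z) (cutoff_nonneg z) (by positivity)
          _ = L * |n * y * deriv cutoff (n * y)| := by
              rw [abs_mul, abs_mul, abs_mul, abs_of_nonneg hy]; ring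
          _ ≤ L * B := by gcongr; exact hB _
      have b1 := bound (x - s) (n * (t - x)) (by linarith [hx.1]) h1
      have b2 := bound (t - x) (n * (x - s)) (by linarith [hx.2]) h2
      rw [e]
      calc _ ≤ _ := abs_sub _ _
        _ ≤ 2 * L * B := by linarith
    rw [Real.norm_eq_abs, mul_assoc, ← mul_pow, abs_mul, abs_of_pos hp, abs_pow]
    gcongr
  · exact (hpc.mul continuous_const).intervalIntegrable _ _
  · have hne : ∀ᵐ x : ℝ ∂volume, x ≠ t := by
      simp [ae_iff, measure_singleton]
    filter_upwards [hne] with x hxt hx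
    rw [uIoc_of_le hst.le] at hx
    refine tendsto_const_nhds.congr' ?_
    filter_upwards [eventually_intervalCutoff ⟨hx.1, lt_of_le_of_ne hx.2 hxt⟩] with n hn
    simp [hn.2]

lemma IsJacobiPair.tendsto_mass (hw : IsJacobiPair a g w P) (h : IsCatenoidProfile a g)
    {s t : ℝ} (hst : s < t) :
    Filter.Tendsto (fun n : ℕ => ∫ x in s..t,
      g x ^ 2 / a * w x ^ 2 * intervalCutoff s t n x ^ 2) Filter.atTop
      (𝓝 (∫ x in s..t, g x ^ 2 / a * w x ^ 2)) := by
  have hwc : Continuous w := (hw.contDiff_infty h).continuous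
  have hgc := h.contDiff.continuous
  have ha := h.init_pos
  refine intervalIntegral.tendsto_integral_filter_of_dominated_convergence
    (fun x => g x ^ 2 / a * w x ^ 2) ?_ ?_ ?_ ?_
  · refine Filter.Eventually.of_forall fun n => Continuous.aestronglyMeasurable ?_
    have := (contDiff_intervalCutoff s t n).continuous
    fun_prop
  · refine Filter.Eventually.of_forall fun n => Filter.Eventually.of_forall fun x _ => ?_
    have h0 : 0 ≤ intervalCutoff s t n x := mul_nonneg (cutoff_nonneg _) (cutoff_nonneg _)
    have h1 : intervalCutoff s t n x ≤ 1 :=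
      mul_le_one₀ (cutoff_le_one _) (cutoff_nonneg _) (cutoff_le_one _)
    rw [Real.norm_of_nonneg (by positivity)]
    exact mul_le_of_le_one_right (by positivity) (pow_le_one₀ h0 h1)
  · exact Continuous.intervalIntegrable (by fun_prop) _ _
  · have hne : ∀ᵐ x : ℝ ∂volume, x ≠ t := by
      simp [ae_iff, measure_singleton]
    filter_upwards [hne] with x hxt hx
    rw [uIoc_of_le hst.le] at hx
    refine tendsto_const_nhds.congr' ?_
    filter_upwards [eventually_intervalCutoff ⟨hx.1, lt_of_le_of_ne hx.2 hxt⟩] with n hn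
    simp [hn.1]

lemma surfaceIntegral_of_rotInvariant {F : (Fin 2 → ℝ) → ℝ} {G : ℝ → ℝ}
    (hF : ∀ q, F q * areaDensity (revMap g) q = G (q 0)) :
    surfaceIntegral g F = 2 * Real.pi * ∫ t, G t := by
  simp only [surfaceIntegral, hF]
  simp [integral_const_mul]

/-- The Jacobi energy of `w χ`, for a Jacobi field `w` and a cutoff `χ`, involves only `χ'`, because
`(w χ) (D J (w χ)) = p w² χ'² - (p w² χ χ')'`. -/
lemma IsJacobiPair.surfaceIntegral_cutoff (hw : IsJacobiPair a g w P)
    (h : IsCatenoidProfile a g) {s t : ℝ} (hst : s < t) {n : ℕ} (hn : n ≠ 0) :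
    surfaceIntegral g (fun q => (w (q 0) * intervalCutoff s t n (q 0)) *
      jacobiOp (revMap g) (revNormal g) (fun q => w (q 0) * intervalCutoff s t n (q 0)) q) =
    2 * Real.pi * ∫ x in s..t, fluxCoeff a g x * w x ^ 2 * intervalCutoffDeriv s t n x ^ 2 := by
  have ha := h.init_pos
  set χ := intervalCutoff s t n with hχ
  set χ' := intervalCutoffDeriv s t n with hχ'
  have hχd : ∀ x, HasDerivAt χ (χ' x) x := hasDerivAt_intervalCutoff s t n
  have hχs : ContDiff ℝ ∞ χ := contDiff_intervalCutoff s t n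
  have hχe : χ' = deriv χ := funext fun x => (hχd x).deriv.symm
  have hχ's : ContDiff ℝ ∞ χ' := by
    rw [hχe]
    exact (contDiff_infty_iff_deriv.1 hχs).2
  have hχ'd : ∀ x, HasDerivAt χ' (deriv χ' x) x := fun x =>
    (hχ's.differentiable (by simp) x).hasDerivAt
  have hpd : ∀ x, HasDerivAt (fluxCoeff a g) (deriv (fluxCoeff a g) x) x := fun x =>
    (h.contDiff_fluxCoeff.differentiable (by simp) x).hasDerivAt
  have hwd := hw.hasDerivAt
  have hE : ∀ x, HasDerivAt (fun x => w x * χ x) (P x / fluxCoeff a g x * χ x + w x * χ' x) x :=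
    fun x => (hwd x).mul (hχd x)
  -- the flux of `w χ` is `P χ + p w χ'`; `Q'` is the derivative of its second term
  set Q' : ℝ → ℝ := fun x => (deriv (fluxCoeff a g) x * w x + fluxCoeff a g x *
    (P x / fluxCoeff a g x)) * χ' x + fluxCoeff a g x * w x * deriv χ' x with hQ'
  have hQ : ∀ x, HasDerivAt (fun x => fluxCoeff a g x * w x * χ' x) (Q' x) x := fun x =>
    ((hpd x).mul (hwd x)).mul (hχ'd x)
  have hF : ∀ x, HasDerivAt
      (fun x => fluxCoeff a g x * (P x / fluxCoeff a g x * χ x + w x * χ' x))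
      (-(potentialDensity a g x * w x) * χ x + P x * χ' x + Q' x) x := by
    intro x
    refine ((((hw.hasDerivAt_flux x).mul (hχd x)).add (hQ x)).congr_of_eventuallyEq ?_)
    refine Filter.Eventually.of_forall fun y => ?_
    have := fluxCoeff_pos (g := g) ha y
    simp only [Pi.add_apply, Pi.mul_apply]
    field_simp
  rw [surfaceIntegral_of_rotInvariant
    (G := fun x => -(w x * χ x) * (P x * χ' x + Q' x))]
  swap
  · intro q
    rw [mul_assoc, h.jacobiOp_comp hE hF]
    ring
  congr 1
  have hsupp : ∀ x, x ≤ s + (n : ℝ)⁻¹ ∨ t - (n : ℝ)⁻¹ ≤ x → χ x = 0 :=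
    fun x => intervalCutoff_eq_zero hn
  have hninv : (0 : ℝ) < (n : ℝ)⁻¹ := by positivity
  have hs0 : χ s = 0 := hsupp s (Or.inl (by linarith))
  have ht0 : χ t = 0 := hsupp t (Or.inr (by linarith))
  rw [← setIntegral_eq_integral_of_forall_compl_eq_zero (s := Ioc s t),
    ← intervalIntegral.integral_of_le hst.le]
  swap
  · intro x hx
    have : χ x = 0 := hsupp x <| by
      simp only [mem_Ioc, not_and_or, not_le, not_lt] at hx
      exact hx.imp (fun h => by linarith) (fun h => by linarith)
    simp [this]
  have hwc : Continuous w := (hw.contDiff_infty h).continuous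
  have hPc : Continuous P :=
    continuous_iff_continuousAt.2 fun t => (hw.hasDerivAt_flux t).continuousAt
  have hpc := h.contDiff_fluxCoeff.continuous
  have hpc' : Continuous (deriv (fluxCoeff a g)) := h.contDiff_fluxCoeff.continuous_deriv (by simp)
  have hχc := hχs.continuous
  have hχc' := hχ's.continuous
  have hχc'' : Continuous (deriv χ') := hχ's.continuous_deriv (by simp)
  have hPp : Continuous fun x => P x / fluxCoeff a g x :=
    hPc.div hpc fun x => (fluxCoeff_pos ha x).ne'
  have hcG : Continuous fun x => -(w x * χ x) * (P x * χ' x + Q' x) := by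
    simp only [hQ']
    fun_prop
  have hcR : Continuous fun x => fluxCoeff a g x * w x ^ 2 * χ' x ^ 2 := by fun_prop
  have hsub := intervalIntegral.integral_eq_sub_of_hasDerivAt (a := s) (b := t)
    (f := fun x => -((w x * χ x) * (fluxCoeff a g x * w x * χ' x)))
    (f' := fun x => -(w x * χ x) * (P x * χ' x + Q' x) - fluxCoeff a g x * w x ^ 2 * χ' x ^ 2)
    (fun x _ => by
      refine ((hE x).mul (hQ x)).neg.congr_deriv ?_
      have := fluxCoeff_pos (g := g) ha x
      field_simp
      ring)
    ((hcG.sub hcR).intervalIntegrable _ _)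
  rw [intervalIntegral.integral_sub (hcG.intervalIntegrable _ _) (hcR.intervalIntegrable _ _)]
    at hsub
  simp only [hs0, ht0, mul_zero, zero_mul, neg_zero, sub_zero] at hsub
  linarith

lemma surfaceIntegral_cutoff_sq (h : IsCatenoidProfile a g) {s t : ℝ} (hst : s < t) {n : ℕ}
    (hn : n ≠ 0) :
    surfaceIntegral g (fun q => (w (q 0) * intervalCutoff s t n (q 0)) ^ 2) =
    2 * Real.pi * ∫ x in s..t, g x ^ 2 / a * w x ^ 2 * intervalCutoff s t n x ^ 2 := by
  rw [surfaceIntegral_of_rotInvariant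
    (G := fun x => g x ^ 2 / a * w x ^ 2 * intervalCutoff s t n x ^ 2)]
  · congr 1
    rw [intervalIntegral.integral_of_le hst.le, setIntegral_eq_integral_of_forall_compl_eq_zero]
    intro x hx
    have hninv : (0 : ℝ) < (n : ℝ)⁻¹ := by positivity
    have : intervalCutoff s t n x = 0 := intervalCutoff_eq_zero hn <| by
      simp only [mem_Ioc, not_and_or, not_le, not_lt] at hx
      exact hx.imp (fun h => by linarith) (fun h => by linarith)
    simp [this]
  · intro q
    rw [h.areaDensity_eq]; ring

/-- No positive constant bounds the Rayleigh quotients of the cutoffs of `w` from below. -/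
lemma IsJacobiPair.nonpos_of_mul_le (hw : IsJacobiPair a g w P) (h : IsCatenoidProfile a g)
    {s t : ℝ} (hst : s < t) (hs : w s = 0) (ht : w t = 0) (hpos : ∀ x ∈ Ioo s t, 0 < w x) {c : ℝ}
    (hc : ∀ n : ℕ, n ≠ 0 →
      c * surfaceIntegral g (fun q => (w (q 0) * intervalCutoff s t n (q 0)) ^ 2) ≤
      surfaceIntegral g (fun q => (w (q 0) * intervalCutoff s t n (q 0)) *
        jacobiOp (revMap g) (revNormal g) (fun q => w (q 0) * intervalCutoff s t n (q 0)) q)) :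
    c ≤ 0 := by
  have ha := h.init_pos
  have h1 := (hw.tendsto_mass h hst).const_mul c
  have h2 := hw.tendsto_energy h hst hs ht
  have hle := le_of_tendsto_of_tendsto h1 h2 <| by
    filter_upwards [Filter.eventually_ne_atTop 0] with n hn
    have := hc n hn
    rw [hw.surfaceIntegral_cutoff h hst hn, surfaceIntegral_cutoff_sq h hst hn] at this
    have hpi := Real.two_pi_pos
    exact le_of_mul_le_mul_left (by linarith) hpi
  have hmass : 0 < ∫ x in s..t, g x ^ 2 / a * w x ^ 2 := by
    refine intervalIntegral.intervalIntegral_pos_of_pos_on ?_ (fun x hx => ?_) hst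
    · have := (hw.contDiff_infty h).continuous
      have := h.contDiff.continuous
      exact Continuous.intervalIntegrable (by fun_prop) _ _
    · have := hpos x hx
      have := h.pos x
      positivity
  exact nonpos_of_mul_nonpos_left hle hmass

end

section

open MeasureTheory Set

/-! ### Topology of the surface of revolution -/

variable {a : ℝ} {g w P : ℝ → ℝ}

lemma revMap_two (q : Fin 2 → ℝ) : revMap g q 2 = q 0 := rfl

lemma revMap_add_period (q : Fin 2 → ℝ) :
    revMap g (q + Pi.single 1 (2 * Real.pi)) = revMap g q := by
  simp [revMap]

lemma revMap_periodic (t : ℝ) : Function.Periodic (fun θ => revMap g ![t, θ]) (2 * Real.pi) :=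
  fun θ => by simp [revMap]

lemma exists_angle {p : Nil} (hp : p ∈ revSurface g) :
    ∃ θ ∈ Icc 0 (2 * Real.pi), p = revMap g ![p 2, θ] := by
  obtain ⟨q, rfl⟩ := hp
  obtain ⟨θ, hθ, e⟩ := (revMap_periodic (g := g) (q 0)).exists_mem_Ico₀ Real.two_pi_pos (q 1)
  refine ⟨θ, Ico_subset_Icc_self hθ, ?_⟩
  rw [revMap_two, ← e, ← eq_vec_two]

lemma rot_revMap (θ : ℝ) (q : Fin 2 → ℝ) : rot θ (revMap g q) = revMap g ![q 0, q 1 + θ] := by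
  funext i
  fin_cases i <;> simp [rot, revMap, Real.cos_add, Real.sin_add] <;> ring

lemma continuous_revMap (hg : Continuous g) : Continuous (revMap g) :=
  contDiff_zero.1 (revMap_contDiff (contDiff_zero.2 hg))

lemma isClosed_revSurface (hg : Continuous g) (hpos : ∀ t, 0 < g t) : IsClosed (revSurface g) := by
  have : revSurface g = {p : Nil | p 0 ^ 2 + p 1 ^ 2 = g (p 2) ^ 2} := by
    ext p
    constructor
    · rintro ⟨q, rfl⟩
      have := Real.sin_sq_add_cos_sq (q 1)
      simp only [revMap, mem_ofPred_eq, Matrix.cons_val]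
      linear_combination g (q 0) ^ 2 * this
    · intro hp
      set x : ℂ := ⟨p 0, p 1⟩ with hx
      have hn : ‖x‖ = g (p 2) := by
        rw [Complex.norm_eq_sqrt_sq_add_sq, hp.out, Real.sqrt_sq (hpos _).le]
      refine ⟨![p 2, x.arg], ?_⟩
      funext i
      fin_cases i
      · simp [revMap, ← hn, Complex.norm_mul_cos_arg, hx]
      · simp [revMap, ← hn, Complex.norm_mul_sin_arg, hx]
      · simp [revMap]
  rw [this]
  exact isClosed_eq (by fun_prop) (by fun_prop)

/-- The part of the surface between two heights. -/
def slab (g : ℝ → ℝ) (s t : ℝ) : Set Nil := revSurface g ∩ {p | p 2 ∈ Ioo s t}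

lemma isCompact_annulus (hg : Continuous g) (s t : ℝ) : IsCompact (annulus g s t) := by
  have : {q : Fin 2 → ℝ | q 0 ∈ Icc s t ∧ q 1 ∈ Icc 0 (2 * Real.pi)} =
      Set.pi univ ![Icc s t, Icc 0 (2 * Real.pi)] := by
    ext q; simp [Set.mem_pi, Fin.forall_fin_two]
  rw [annulus, this]
  refine (isCompact_univ_pi fun i => ?_).image (continuous_revMap hg)
  fin_cases i <;> exact isCompact_Icc

lemma mem_annulus_iff {p : Nil} {s t : ℝ} :
    p ∈ annulus g s t ↔ p ∈ revSurface g ∧ p 2 ∈ Icc s t := by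
  constructor
  · rintro ⟨q, hq, rfl⟩
    exact ⟨⟨q, rfl⟩, hq.1⟩
  · rintro ⟨hp, hst⟩
    obtain ⟨θ, hθ, e⟩ := exists_angle hp
    exact ⟨![p 2, θ], ⟨hst, hθ⟩, e.symm⟩

lemma relInterior_subset {M Ω : Set Nil} : relInterior M Ω ⊆ Ω :=
  fun _ hp => mem_of_mem_nhdsWithin hp.1 hp.2

lemma subset_relInterior_of_isOpen {M O : Set Nil} (hO : IsOpen O) :
    M ∩ O ⊆ relInterior M (M ∩ O) :=
  fun _ hp => ⟨hp.1, Filter.inter_mem self_mem_nhdsWithin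
    (mem_nhdsWithin_of_mem_nhds (hO.mem_nhds hp.2))⟩

lemma isOpen_height {I : Set ℝ} (hI : IsOpen I) : IsOpen {p : Nil | p 2 ∈ I} :=
  hI.preimage (continuous_apply 2)

lemma relInterior_slab (s t : ℝ) : relInterior (revSurface g) (slab g s t) = slab g s t :=
  Subset.antisymm relInterior_subset (subset_relInterior_of_isOpen (isOpen_height isOpen_Ioo))

/-- The meridian through a point, as a curve in the surface. -/
lemma tendsto_meridian (hg : Continuous g) {p : Nil} (hp : p ∈ revSurface g) :
    ∃ γ : ℝ → Nil, (∀ x, γ x 2 = x) ∧ (∀ x, γ x ∈ revSurface g) ∧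
      Filter.Tendsto γ (𝓝 (p 2)) (𝓝[revSurface g] p) := by
  obtain ⟨θ, -, e⟩ := exists_angle hp
  refine ⟨fun x => revMap g ![x, θ], fun x => rfl, fun x => ⟨_, rfl⟩,
    tendsto_nhdsWithin_iff.2 ⟨?_, Filter.Eventually.of_forall fun x => ⟨_, rfl⟩⟩⟩
  have hc : Continuous fun x : ℝ => revMap g ![x, θ] := (continuous_revMap hg).comp (by fun_prop)
  conv => arg 3; rw [e]
  exact hc.tendsto _

lemma relInterior_annulus (hg : Continuous g) (s t : ℝ) :
    relInterior (revSurface g) (annulus g s t) = slab g s t := by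
  ext p
  constructor
  · rintro ⟨hp, hn⟩
    obtain ⟨γ, hγ2, -, hγ⟩ := tendsto_meridian hg hp
    have : Icc s t ∈ 𝓝 (p 2) := by
      filter_upwards [hγ hn] with x hx
      have := (mem_annulus_iff.1 hx).2
      rwa [hγ2] at this
    rw [← mem_interior_iff_mem_nhds, interior_Icc] at this
    exact ⟨hp, this⟩
  · intro hp
    obtain ⟨hpM, hn⟩ := (relInterior_slab (g := g) s t).symm ▸ hp
    exact ⟨hpM, Filter.mem_of_superset hn fun q hq =>
      mem_annulus_iff.2 ⟨hq.1, Ioo_subset_Icc_self hq.2⟩⟩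

lemma isDomainIn_height (hg : Continuous g) {I : Set ℝ} (hI : IsOpen I) (hc : IsConnected I) :
    IsDomainIn (revSurface g) (revSurface g ∩ {p | p 2 ∈ I}) := by
  refine ⟨⟨_, isOpen_height hI, rfl⟩, ?_⟩
  have e : revSurface g ∩ {p | p 2 ∈ I} =
      (fun x : ℝ × ℝ => revMap g ![x.1, x.2]) '' (I ×ˢ univ) := by
    ext p
    constructor
    · rintro ⟨hp, hpI⟩
      obtain ⟨θ, -, e⟩ := exists_angle hp
      exact ⟨(p 2, θ), ⟨hpI, mem_univ _⟩, e.symm⟩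
    · rintro ⟨x, hx, rfl⟩
      exact ⟨⟨_, rfl⟩, hx.1⟩
  rw [e]
  refine (hc.prod isConnected_univ).image _ (Continuous.continuousOn ?_)
  exact (continuous_revMap hg).comp (by fun_prop)

lemma isRotInvariant_height (I : Set ℝ) :
    IsRotInvariant (revSurface g ∩ {p | p 2 ∈ I}) := by
  intro θ
  ext p
  constructor
  · rintro ⟨_, ⟨⟨q, rfl⟩, hq⟩, rfl⟩
    rw [rot_revMap]
    exact ⟨⟨_, rfl⟩, hq⟩
  · rintro ⟨⟨q, rfl⟩, hq⟩
    refine ⟨revMap g ![q 0, q 1 - θ], ⟨⟨_, rfl⟩, hq⟩, ?_⟩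
    rw [rot_revMap, eq_vec_two q]
    simp

/-- A rotationally invariant domain contains the slab between any two of its points. -/
lemma slab_subset {U : Set Nil} (hU : IsDomainIn (revSurface g) U) (hrot : IsRotInvariant U)
    {p p' : Nil} (hp : p ∈ U) (hp' : p' ∈ U) : slab g (p 2) (p' 2) ⊆ U := by
  rintro m ⟨hm, hz⟩
  have hconn : IsPreconnected ((fun p : Nil => p 2) '' U) :=
    hU.2.isPreconnected.image _ (continuous_apply 2).continuousOn
  obtain ⟨r, hr, hrm⟩ := hconn.ordConnected.out ⟨p, hp, rfl⟩ ⟨p', hp', rfl⟩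
    (Ioo_subset_Icc_self hz)
  have hrM : r ∈ revSurface g := by
    obtain ⟨⟨O, -, rfl⟩, -⟩ := hU
    exact hr.1
  obtain ⟨θ, -, hθ⟩ := exists_angle hm
  obtain ⟨θ', -, hθ'⟩ := exists_angle hrM
  rw [← hrot (θ - θ')]
  refine ⟨r, hr, ?_⟩
  change r 2 = m 2 at hrm
  rw [hθ', rot_revMap, hθ, hrm]
  simp

/-- A domain has no point of extreme height, being open in the surface. -/
lemma exists_mem_lt (hg : Continuous g) {U : Set Nil} (hU : IsDomainIn (revSurface g) U) {p : Nil}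
    (hp : p ∈ U) : (∃ p' ∈ U, p' 2 < p 2) ∧ ∃ p' ∈ U, p 2 < p' 2 := by
  obtain ⟨⟨O, hO, rfl⟩, -⟩ := hU
  obtain ⟨γ, hγ2, hγM, hγ⟩ := tendsto_meridian hg hp.1
  have hev : ∀ᶠ x in 𝓝 (p 2), γ x ∈ O :=
    (hγ.mono_right nhdsWithin_le_nhds) (hO.mem_nhds hp.2)
  constructor
  · obtain ⟨x, hx, hlt⟩ := ((hev.filter_mono nhdsWithin_le_nhds : ∀ᶠ x in 𝓝[<] (p 2), γ x ∈ O).and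
      self_mem_nhdsWithin).exists
    exact ⟨γ x, ⟨hγM x, hx⟩, by rw [hγ2]; exact hlt⟩
  · obtain ⟨x, hx, hlt⟩ := ((hev.filter_mono nhdsWithin_le_nhds : ∀ᶠ x in 𝓝[>] (p 2), γ x ∈ O).and
      self_mem_nhdsWithin).exists
    exact ⟨γ x, ⟨hγM x, hx⟩, by rw [hγ2]; exact hlt⟩

/-! ### First eigenvalues -/

lemma rayleighQuotients_nonempty (hg : Continuous g) (hgs : ContDiff ℝ ∞ g)
    (hpos : ∀ t, 0 < g t) {Ω : Set Nil} (hΩ : IsDomainIn (revSurface g) Ω) :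
    (rayleighQuotients g Ω).Nonempty := by
  obtain ⟨⟨O, hO, rfl⟩, ⟨p, hp⟩, -⟩ := hΩ
  obtain ⟨r, hr, hball⟩ := Metric.nhds_basis_closedBall.mem_iff.1 (hO.mem_nhds hp.2)
  let b : ContDiffBump p := ⟨r / 2, r, by positivity, by linarith⟩
  refine ⟨_, fun x => b x, ⟨b.contDiff.comp (revMap_contDiff hgs),
    revSurface g ∩ Metric.closedBall p r,
    (isCompact_closedBall p r).inter_left (isClosed_revSurface hg hpos), ?_, ?_⟩,
    ⟨p, hp.1, ?_⟩, rfl⟩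
  · exact (inter_subset_inter_right _ hball).trans (subset_relInterior_of_isOpen hO)
  · intro x hx hxK
    refine b.zero_of_le_dist ?_
    by_contra! hlt
    exact hxK ⟨hx, Metric.mem_closedBall.2 hlt.le⟩
  · have : b p = 1 := b.one_of_mem_closedBall (Metric.mem_closedBall_self (by positivity))
    exact this.trans_ne one_ne_zero

/-- A strict Riccati subsolution built on a positive Jacobi field bounds from below the Rayleigh
quotient of a test function. -/
lemma IsJacobiPair.le_rayleigh (hw : IsJacobiPair a g w P) (h : IsCatenoidProfile a g) {α β : ℝ}
    (hpos : ∀ t ∈ Icc α β, 0 < w t) {δ c : ℝ}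
    (hδ : ∀ t ∈ Icc α β,
      δ ^ 2 * t ^ 2 / (fluxCoeff a g t * w t ^ 4) + c * (g t ^ 2 / a) ≤ δ / w t ^ 2)
    {Ω : Set Nil} {u : Nil → ℝ} (hu : IsTestFunction g Ω u) (hne : ∃ p ∈ revSurface g, u p ≠ 0)
    (hsupp : ∀ p ∈ revSurface g, p 2 ≤ α ∨ β ≤ p 2 → u p = 0) :
    c ≤ surfaceIntegral g (fun q => u (revMap g q) *
          jacobiOp (revMap g) (revNormal g) (u ∘ revMap g) q)
        / surfaceIntegral g (fun q => u (revMap g q) ^ 2) := by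
  obtain ⟨_, ⟨q, rfl⟩, hq⟩ := hne
  have hs : ∀ q, q 0 ≤ α ∨ β ≤ q 0 → (u ∘ revMap g) q = 0 := fun q hq => hsupp _ ⟨q, rfl⟩ hq
  have hper : ∀ q, (u ∘ revMap g) (q + Pi.single 1 (2 * Real.pi)) = (u ∘ revMap g) q :=
    fun q => by simp only [Function.comp, revMap_add_period]
  have hαβ : α < β := by
    by_contra! hle
    exact hq (hs q ((le_total (q 0) α).imp id fun h' => hle.trans h'))
  have hden := h.surfaceIntegral_sq_pos hu.1.continuous hper hαβ hs (q := q) hq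
  refine (le_div_iff₀ hden).2 ?_
  exact hw.mul_surfaceIntegral_le h hu.1 hper hαβ hs hpos hδ

/-- A domain over whose closed range of heights some Jacobi field is positive is stable. -/
lemma IsJacobiPair.isStable (hw : IsJacobiPair a g w P) (h : IsCatenoidProfile a g) {α β : ℝ}
    (hpos : ∀ t ∈ Icc α β, 0 < w t) {Ω : Set Nil} (hΩ : IsDomainIn (revSurface g) Ω)
    (hsub : ∀ p ∈ Ω, α < p 2 ∧ p 2 < β) : IsStable g Ω := by
  obtain ⟨δ, c, hc, hδ⟩ := hw.exists_riccati h hpos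
  have hlb : ∀ r ∈ rayleighQuotients g Ω, c ≤ r := by
    rintro _ ⟨u, hu, hne, rfl⟩
    refine hw.le_rayleigh h hpos hδ hu hne fun p hp hαβ => ?_
    obtain ⟨-, K, -, hK, hzero⟩ := hu
    refine hzero p hp fun hpK => ?_
    have := hsub p (relInterior_subset (hK hpK))
    rcases hαβ with h' | h' <;> linarith
  have hnon := rayleighQuotients_nonempty h.contDiff.continuous h.contDiff_infty h.pos hΩ
  exact ⟨_, isGLB_csInf hnon ⟨c, hlb⟩, hc.trans_le (le_csInf hnon hlb)⟩

/-- If a Jacobi field is positive between two consecutive zeros `s < t`, the least eigenvalue of the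
slab they bound is zero. -/
lemma IsJacobiPair.isStableUnstable (hw : IsJacobiPair a g w P) (h : IsCatenoidProfile a g)
    {s t : ℝ} (hst : s < t) (hs : w s = 0) (ht : w t = 0) (hpos : ∀ x ∈ Ioo s t, 0 < w x)
    {Ω : Set Nil} (hΩ : relInterior (revSurface g) Ω = slab g s t) : IsStableUnstable g Ω := by
  constructor
  · rintro _ ⟨u, hu, hne, rfl⟩
    obtain ⟨-, K, hKc, hK, hzero⟩ := id hu
    obtain ⟨p₀, hp₀, hup₀⟩ := hne
    have hKne : K.Nonempty := ⟨p₀, by_contra fun h' => hup₀ (hzero p₀ hp₀ h')⟩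
    rw [hΩ] at hK
    obtain ⟨p₁, hp₁, hmin⟩ := hKc.exists_isMinOn hKne (continuous_apply (2 : Fin 3)).continuousOn
    obtain ⟨p₂, hp₂, hmax⟩ := hKc.exists_isMaxOn hKne (continuous_apply (2 : Fin 3)).continuousOn
    have h1 := (hK hp₁).2.1
    have h2 := (hK hp₂).2.2
    refine hw.le_rayleigh h (α := (s + p₁ 2) / 2) (β := (p₂ 2 + t) / 2) (δ := 0)
      (fun x hx => hpos x ⟨by linarith [hx.1], by linarith [hx.2]⟩) (by simp) hu ⟨p₀, hp₀, hup₀⟩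
      fun p hp hαβ => hzero p hp fun hpK => ?_
    have h3 : p₁ 2 ≤ p 2 := hmin hpK
    have h4 : p 2 ≤ p₂ 2 := hmax hpK
    rcases hαβ with h' | h' <;> linarith
  · intro b hb
    refine hw.nonpos_of_mul_le h hst hs ht hpos fun n hn => ?_
    have hn' : (0 : ℝ) < (n : ℝ)⁻¹ := by positivity
    set u : Nil → ℝ := fun p => w (p 2) * intervalCutoff s t n (p 2) with hu
    by_cases hne : ∃ p ∈ revSurface g, u p ≠ 0
    · have hus : ContDiff ℝ ∞ (u ∘ revMap g) :=
        ((hw.contDiff_infty h).comp (contDiff_apply ℝ ℝ (0 : Fin 2))).mul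
          ((contDiff_intervalCutoff s t n).comp (contDiff_apply ℝ ℝ (0 : Fin 2)))
      have htest : IsTestFunction g Ω u := by
        refine ⟨hus, annulus g (s + (n : ℝ)⁻¹) (t - (n : ℝ)⁻¹),
          isCompact_annulus h.contDiff.continuous _ _, ?_, fun p hp hpK => ?_⟩
        · rw [hΩ]
          intro p hp
          obtain ⟨hpM, hpI⟩ := mem_annulus_iff.1 hp
          exact ⟨hpM, by linarith [hpI.1], by linarith [hpI.2]⟩
        · rw [mem_annulus_iff, not_and, mem_Icc, not_and_or, not_le, not_le] at hpK
          simp only [hu]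
          rw [intervalCutoff_eq_zero hn ((hpK hp).imp le_of_lt le_of_lt), mul_zero]
      have hle := hb ⟨u, htest, hne, rfl⟩
      obtain ⟨_, ⟨q, rfl⟩, hq⟩ := hne
      have hden := h.surfaceIntegral_sq_pos hus.continuous
        (fun q => by simp only [Function.comp, revMap_add_period]) hst (fun q hq => by
          simp only [Function.comp, hu, revMap_two]
          rw [intervalCutoff_eq_zero hn (hq.imp (fun h => by linarith) (fun h => by linarith)),
            mul_zero]) (q := q) hq
      exact (le_div_iff₀ hden).1 hle
    · push Not at hne
      have hz : ∀ q : Fin 2 → ℝ, w (q 0) * intervalCutoff s t n (q 0) = 0 :=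
        fun q => hne _ ⟨q, rfl⟩
      simp only [hz, zero_mul]
      simp [surfaceIntegral]

/-! ### Conjugate heights and the half-catenoids -/

/-- The heights `-t₁ < 0 < t₂` are conjugate when the ratio `e / φ` takes opposite values at `t₁`
and `t₂`: the Jacobi field `e + (e / φ)(t₁) φ` vanishes at both and is positive in between. -/
lemma IsCatenoidProfile.exists_pair (h : IsCatenoidProfile a g) {t₁ t₂ : ℝ} (h₁ : 0 < t₁)
    (h₂ : 0 < t₂) (hconj : parameterField a g t₁ / verticalField a g t₁ +
      parameterField a g t₂ / verticalField a g t₂ = 0) :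
    ∃ w P, IsJacobiPair a g w P ∧ w (-t₁) = 0 ∧ w t₂ = 0 ∧ ∀ x ∈ Ioo (-t₁) t₂, 0 < w x := by
  set H := fun t => parameterField a g t / verticalField a g t with hH
  have hHdef : ∀ t, 0 < t → parameterField a g t = H t * verticalField a g t := fun t ht => by
    have := h.verticalField_pos ht
    simp only [hH]
    field_simp
  have hconj' : H t₁ + H t₂ = 0 := hconj
  refine ⟨_, _, h.isJacobiPair_parameter.add_const_mul h.isJacobiPair_vertical (H t₁), ?_, ?_, ?_⟩
  · rw [h.parameterField_neg, h.verticalField_neg, hHdef t₁ h₁]; ring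
  · rw [hHdef t₂ h₂]; linear_combination verticalField a g t₂ * hconj'
  · intro x hx
    rcases lt_trichotomy x 0 with hx0 | rfl | hx0
    · have hneg : 0 < -x := by linarith
      have hlt : H t₁ < H (-x) := h.strictAntiOn_ratio hneg h₁ (by linarith [hx.1])
      have e1 : parameterField a g x = H (-x) * verticalField a g (-x) := by
        rw [← hHdef _ hneg, h.parameterField_neg]
      have e2 : verticalField a g x = -verticalField a g (-x) := by
        rw [h.verticalField_neg, neg_neg]
      have := h.verticalField_pos hneg
      rw [e1, e2]
      nlinarith
    · simp [parameterField_zero, h.verticalField_zero]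
    · have hlt : H t₂ < H x := h.strictAntiOn_ratio hx0 h₂ hx.2
      have := h.verticalField_pos hx0
      rw [hHdef x hx0]
      nlinarith

namespace IsCatenoidProfile

lemma isStableUnstable_annulus (h : IsCatenoidProfile a g) {t₁ t₂ : ℝ} (h₁ : 0 < t₁)
    (h₂ : 0 < t₂) (hconj : parameterField a g t₁ / verticalField a g t₁ +
      parameterField a g t₂ / verticalField a g t₂ = 0) :
    IsStableUnstable g (annulus g (-t₁) t₂) := by
  obtain ⟨w, P, hw, hs, ht, hpos⟩ := h.exists_pair h₁ h₂ hconj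
  exact hw.isStableUnstable h (by linarith) hs ht hpos (relInterior_annulus h.contDiff.continuous _ _)

lemma exists_conjugate (h : IsCatenoidProfile a g) (t : ℝ) :
    ∃ t', 0 < t' ∧ parameterField a g t / verticalField a g t +
      parameterField a g t' / verticalField a g t' = 0 := by
  obtain ⟨t', ht', e⟩ := h.exists_ratio_eq (-(parameterField a g t / verticalField a g t))
  exact ⟨t', ht', by rw [e]; ring⟩

/-- An r-stable rotationally invariant domain does not reach two conjugate heights. -/
lemma not_conjugate (h : IsCatenoidProfile a g) {U : Set Nil} (hU : IsRotRStableDomain g U)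
    {p p' : Nil} (hp : p ∈ U) (hp' : p' ∈ U) (h₁ : p 2 < 0) (h₂ : 0 < p' 2) :
    parameterField a g (-p 2) / verticalField a g (-p 2) +
      parameterField a g (p' 2) / verticalField a g (p' 2) ≠ 0 := by
  intro hconj
  obtain ⟨hdom, hrot, hst⟩ := hU
  obtain ⟨w, P, hw, hs, ht, hpos⟩ := h.exists_pair (neg_pos.2 h₁) h₂ hconj
  rw [neg_neg] at hs hpos
  have hlt : p 2 < p' 2 := h₁.trans h₂
  have hzero := hw.isStableUnstable h hlt hs ht hpos (relInterior_slab _ _)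
  obtain ⟨lam, hlam, hlam0⟩ := hst (slab g (p 2) (p' 2)) (slab_subset hdom hrot hp hp')
    (isDomainIn_height h.contDiff.continuous isOpen_Ioo (isConnected_Ioo hlt))
    ⟨annulus g (p 2) (p' 2), isCompact_annulus h.contDiff.continuous _ _,
      fun q hq => (mem_annulus_iff.1 hq).1,
      fun q hq => mem_annulus_iff.2 ⟨hq.1, Ioo_subset_Icc_self hq.2⟩⟩
  exact hlam0.ne' (hlam.unique hzero)

lemma exists_height_bound {M Ω : Set Nil} (hΩ : IsRelCompactIn M Ω) :
    ∃ T : ℝ, 0 < T ∧ ∀ p ∈ Ω, |p 2| < T := by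
  obtain ⟨K, hK, -, hsub⟩ := hΩ
  obtain ⟨C, hC⟩ := hK.exists_bound_of_continuousOn (f := fun p : Nil => p 2)
    (continuous_apply 2).continuousOn
  refine ⟨|C| + 1, by positivity, fun p hp => ?_⟩
  have : |p 2| ≤ C := hC p (hsub hp)
  linarith [le_abs_self C]

lemma isRStable_upperHalf (h : IsCatenoidProfile a g) : IsRStable g (upperHalf g) := by
  intro Ω hsub hdom hrel
  obtain ⟨T, hT, hΩT⟩ := exists_height_bound hrel
  obtain ⟨t₁, h₁, hconj⟩ := h.exists_conjugate (T + 1)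
  obtain ⟨w, P, hw, -, -, hpos⟩ := h.exists_pair h₁ (by linarith) ((add_comm _ _).trans hconj)
  refine hw.isStable h (α := -t₁ / 2) (β := T)
    (fun x hx => hpos x ⟨by linarith [hx.1], by linarith [hx.2]⟩) hdom fun p hp => ?_
  have h0 : 0 < p 2 := (hsub hp).2
  exact ⟨by linarith, (abs_lt.1 (hΩT p hp)).2⟩

lemma isRStable_lowerHalf (h : IsCatenoidProfile a g) : IsRStable g (lowerHalf g) := by
  intro Ω hsub hdom hrel
  obtain ⟨T, hT, hΩT⟩ := exists_height_bound hrel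
  obtain ⟨t₂, h₂, hconj⟩ := h.exists_conjugate (T + 1)
  obtain ⟨w, P, hw, -, -, hpos⟩ := h.exists_pair (by linarith) h₂ hconj
  refine hw.isStable h (α := -T) (β := t₂ / 2)
    (fun x hx => hpos x ⟨by linarith [hx.1], by linarith [hx.2]⟩) hdom fun p hp => ?_
  have h0 : p 2 < 0 := (hsub hp).2
  exact ⟨(abs_lt.1 (hΩT p hp)).1, by linarith⟩

lemma maximal_upperHalf (h : IsCatenoidProfile a g) :
    Maximal (IsRotRStableDomain g) (upperHalf g) := by
  have hg := h.contDiff.continuous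
  refine ⟨⟨isDomainIn_height hg isOpen_Ioi isConnected_Ioi, isRotInvariant_height (Ioi 0),
    h.isRStable_upperHalf⟩, fun U hU hle p hp => ?_⟩
  have hpM : p ∈ revSurface g := by
    obtain ⟨⟨⟨O, -, rfl⟩, -⟩, -⟩ := hU
    exact hp.1
  refine ⟨hpM, ?_⟩
  by_contra hp0
  obtain ⟨p', hp', hlt⟩ := (exists_mem_lt hg hU.1 hp).1
  have hneg : p' 2 < 0 := hlt.trans_le (not_lt.1 hp0)
  obtain ⟨t₂, h₂, hconj⟩ := h.exists_conjugate (-p' 2)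
  exact h.not_conjugate hU hp' (hle ⟨⟨![t₂, 0], rfl⟩, h₂⟩) hneg h₂ hconj

lemma maximal_lowerHalf (h : IsCatenoidProfile a g) :
    Maximal (IsRotRStableDomain g) (lowerHalf g) := by
  have hg := h.contDiff.continuous
  refine ⟨⟨isDomainIn_height hg isOpen_Iio isConnected_Iio, isRotInvariant_height (Iio 0),
    h.isRStable_lowerHalf⟩, fun U hU hle p hp => ?_⟩
  have hpM : p ∈ revSurface g := by
    obtain ⟨⟨⟨O, -, rfl⟩, -⟩, -⟩ := hU
    exact hp.1
  refine ⟨hpM, ?_⟩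
  by_contra hp0
  obtain ⟨p', hp', hlt⟩ := (exists_mem_lt hg hU.1 hp).2
  have hpos : 0 < p' 2 := (not_lt.1 hp0).trans_lt hlt
  obtain ⟨t₁, h₁, hconj⟩ := h.exists_conjugate (p' 2)
  have hneg : -t₁ < 0 := neg_neg_of_pos h₁
  refine h.not_conjugate hU (p := revMap g ![-t₁, 0]) (hle ⟨⟨![-t₁, 0], rfl⟩, hneg⟩) hp' hneg hpos ?_
  rw [revMap_two, add_comm]
  simpa using hconj

end IsCatenoidProfile

end

end NilCatenoid

end

theorem theorem1 :
    ∃ f : ℝ → ℝ → ℝ,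
      (∀ a : ℝ, 0 < a → NilCatenoid.IsCatenoidProfile a (f a) ∧
        ∀ g : ℝ → ℝ, NilCatenoid.IsCatenoidProfile a g → g = f a) ∧
      ∀ a : ℝ, 0 < a →
        -- (i) the two half-catenoids are r-stable
        (NilCatenoid.IsRStable (f a) (NilCatenoid.upperHalf (f a)) ∧
          NilCatenoid.IsRStable (f a) (NilCatenoid.lowerHalf (f a))) ∧
        -- (ii) the Jacobi field coming from the variation of the parameter
        ((∀ q : Fin 2 → ℝ,
            NilCatenoid.jacobiOp (NilCatenoid.revMap (f a)) (NilCatenoid.revNormal (f a))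
              (NilCatenoid.variationJacobi f a) q = 0) ∧
          (∀ t θ θ' : ℝ, NilCatenoid.variationJacobi f a ![t, θ]
            = NilCatenoid.variationJacobi f a ![t, θ']) ∧
          (∀ t θ : ℝ, NilCatenoid.variationJacobi f a ![-t, θ]
            = NilCatenoid.variationJacobi f a ![t, θ]) ∧
          ∃ z : ℝ, 0 < z ∧
            (∀ t : ℝ, 0 < t → ∀ θ : ℝ,
              NilCatenoid.variationJacobi f a ![t, θ] = 0 ↔ t = z) ∧
            NilCatenoid.IsStableUnstable (f a) (NilCatenoid.annulus (f a) (-z) z)) ∧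
        -- (iii) stable-unstable annuli, and maximality of the half-catenoids
        ((∀ t₁ : ℝ, 0 < t₁ → ∃ t₂ : ℝ, 0 < t₂ ∧
            NilCatenoid.IsStableUnstable (f a) (NilCatenoid.annulus (f a) (-t₁) t₂)) ∧
          Maximal (NilCatenoid.IsRotRStableDomain (f a)) (NilCatenoid.upperHalf (f a)) ∧
          Maximal (NilCatenoid.IsRotRStableDomain (f a)) (NilCatenoid.lowerHalf (f a))) := by
  refine ⟨NilCatenoid.profile, fun a ha => ⟨NilCatenoid.isCatenoidProfile_profile ha,
    fun g hg => hg.unique (NilCatenoid.isCatenoidProfile_profile ha)⟩, fun a ha => ?_⟩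
  have h := NilCatenoid.isCatenoidProfile_profile ha
  refine ⟨⟨h.isRStable_upperHalf, h.isRStable_lowerHalf⟩, ⟨fun q => ?_, fun t θ θ' => ?_,
    fun t θ => ?_, ?_⟩, fun t₁ h₁ => ?_, h.maximal_upperHalf, h.maximal_lowerHalf⟩
  · rw [funext (NilCatenoid.variationJacobi_profile ha)]
    exact h.isJacobiPair_parameter.jacobiOp_eq_zero h q
  · simp [NilCatenoid.variationJacobi_profile ha]
  · simp [NilCatenoid.variationJacobi_profile ha, h.parameterField_neg]
  · obtain ⟨z, hz, hz0⟩ := h.exists_ratio_eq 0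
    refine ⟨z, hz, fun t ht θ => ?_, h.isStableUnstable_annulus hz hz (by rw [hz0, add_zero])⟩
    have hne : ∀ s, 0 < s → (NilCatenoid.parameterField a (NilCatenoid.profile a) s = 0 ↔
        NilCatenoid.parameterField a (NilCatenoid.profile a) s /
          NilCatenoid.verticalField a (NilCatenoid.profile a) s = 0) := fun s hs => by
      simp [(h.verticalField_pos hs).ne']
    rw [NilCatenoid.variationJacobi_profile ha]
    change NilCatenoid.parameterField a (NilCatenoid.profile a) t = 0 ↔ t = z
    rw [hne t ht, ← hz0]
    exact h.strictAntiOn_ratio.injOn.eq_iff ht hz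
  · obtain ⟨t₂, h₂, hconj⟩ := h.exists_conjugate t₁
    exact ⟨t₂, h₂, h.isStableUnstable_annulus h₁ h₂ hconj⟩
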